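/- **Setting.** Let $E$ be an effect algebra with orthosupplement $a\mapsto a'$, ordered by $a\le b$ iff $a\oplus c=b$ for some $c$ (and then $b\ominus a:=c$). Elements $a,b$ are Mackey compatible, $a\leftrightarrow b$, if $a=a_1\oplus c$, $b=b_1\oplus c$ for some $a_1,b_1,c$ such that $a_1\oplus b_1\oplus c$ exists. $E$ is *archimedean* if $a=0$ whenever $na$ exists for all $n\in\mathbb N$. A *compression* is an additive map $J:E\to E$ such that $a\le J(1)$ implies $J(a)=a$, and $J(a)=0$ iff $a\le J(1)'$. A *compression base* is a family $(J_p)_{p\in P}$ of compressions, indexed by a sub-effect algebra $P\subseteq E$ (whose elements are called projections), with $J_p(1)=p$, and such that for Mackey compatible $p,q\in P$ there is $r\in P$ with $J_p\circ J_q=J_r$. For $p\in P$ put $C(p)=\{a\in E: a=J_p(a)\oplus J_{p'}(a)\}$; for $A\subseteq E$ put $PC(A)=\{p\in P: A\subseteq C(p)\}$ and $P(A)=PC(PC(A)\cup A)$; we write $P(a)=P(\{a\})$ and $P(a,b)=P(\{a,b\})$. Elements $a,b$ commute, $aCb$, if $p\leftrightarrow q$ for all $p\in P(a)$, $q\in P(b)$.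 Put $$P_\le(a,b)=\{p\in P(a,b): J_p(a)\le J_p(b),\ J_{p'}(b)\le J_{p'}(a)\}.$$ $E$ is *spectral* (with respect to $(J_p)_{p\in P}$) if 1. for every $a$ there is a Boolean subalgebra $B(a)\subseteq P$ such that for all $p\in P$: $a\in C(p)$ iff $B(a)\subseteq C(p)$; 2. $P_\le(a,b)\neq\emptyset$ whenever $aCb$; 3. every $a$ has a projection cover $a^\circ\in P$, i.e. for all $q\in P$: $a\le q$ iff $a^\circ\le q$. If $aCb$, then $(b-a)_+:=J_p(b)\ominus J_p(a)$ for any $p\in P_\le(a,b)$ (the value does not depend on $p$). **Binary spectral projections.** For $a\in E$ and finite binary strings $w$, define $c_w,u_w\in E$ recursively by $c_\varepsilon=a$, $u_\varepsilon=a^\circ$, and $$u_{w0}=\big((c_w-c_w')_+{}^{\circ}\big)'\wedge u_w,\quad u_{w1}=u_w\wedge u_{w0}',\quad c_{w0}=u_{w0}\ominus[(c_w'-c_w)_+\wedge u_w],\quad c_{w1}=(c_w-c_w')_+\wedge u_w .$$ Let $p^{\mathrm{bin}}_{a,0}=(a^\circ)'$, $p^{\mathrm{bin}}_{a,1}=1$;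 every dyadic rational $\mu\in(0,1)$ is uniquely $\mu=\sum_{j=1}^{n}w_j2^{-j}+2^{-(n+1)}$ with $w=w_1\cdots w_n\in\{0,1\}^n$, $n\ge 0$, and $$p^{\mathrm{bin}}_{a,\mu}=(a^\circ)'\oplus\bigoplus_{\tilde w\in\{0,1\}^{n+1},\ \tilde w\le w0}u_{\tilde w}$$ (lexicographic order). **Spectral projections in a C-block.** A *block* is a maximal set $B\subseteq P$ of pairwise Mackey compatible projections, and $C=C(B)=\bigcap_{p\in B}C(p)$ is the corresponding *C-block*; it is a sub-effect algebra of $E$, and $J_p(C)\subseteq C$ for $p\in B$. Let $G$ be the universal group of $C$ (the abelian group generated by $C$ subject to $a+b=a\oplus b$ whenever $a\oplus b$ exists in $C$), with positive cone $G^+$ generated by $C$, and let $\tilde U_p:G\to G$, $p\in B$, be the group endomorphism extending $J_p|_C$. For $g\in G$, the positive part $g_+$ is given by the orthogonal decomposition $g=g_+-g_-$, $g_\pm\in G^+$, where $\tilde U_p(g)=g_+$ and $\tilde U_{p'}(g)=-g_-$ for some $p\in B$; and $g^*\in B$ is the projection such that for all $p\in B$: $p\le g^*$ iff $g=\tilde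 U_p(g)+\tilde U_{p'}(g)$ and $\tilde U_p(g)=0$. For $a\in C$ and $\lambda=m/n$ with $m\in\mathbb Z$, $n\in\mathbb N$, $n>0$, put $$p^C_{a,\lambda}=\big((na-m1)_+\big)^* .$$ **Theorem.** Let $E$ be an archimedean spectral effect algebra and $a\in E$. There is a unique family of projections $(p_{a,\lambda})_{\lambda\in[0,1]\cap\mathbb Q}$ in $P$ (the rational spectral resolution of $a$) such that for every $\lambda\in[0,1]\cap\mathbb Q$: * for every C-block $C$ containing $a$ and every representation $\lambda=m/n$, the projection $p^C_{a,\lambda}=((na-m1)_+)^*$ exists, is uniquely determined, and equals $p_{a,\lambda}$; in particular, it does not depend on $C$; * $p_{a,\lambda}$ is the infimum in $E$ of the binary spectral projections $p^{\mathrm{bin}}_{a,\mu}$ over all dyadic rationals $\mu\in[0,1]$ with $\mu>\lambda$ (for $\lambda=1$ the set is empty and the infimum is $1$). -/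

import Mathlib

/-- An effect algebra: `oplus a b = some c` means that `a ⊕ b` is defined and equal to `c`. -/
class EffectAlgebra (E : Type*) extends Zero E, One E where
  oplus : E → E → Option E
  oplus_comm' : ∀ a b c : E, oplus a b = some c → oplus b a = some c
  oplus_assoc' : ∀ a b c d e : E, oplus a b = some d → oplus d c = some e →
    ∃ f, oplus b c = some f ∧ oplus a f = some e
  existsUnique_orth : ∀ a : E, ∃! b : E, oplus a b = some 1
  eq_zero_of_oplus_one : ∀ a b : E, oplus a 1 = some b → a = 0

namespace EffectAlgebra

/-- The orthosupplement `a'`: the unique element with `a ⊕ a' = 1`. -/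
noncomputable def orth {E : Type*} [EffectAlgebra E] (a : E) : E :=
  (existsUnique_orth a).choose

section basic

variable {E : Type*} [EffectAlgebra E]

theorem oplus_orth (a : E) : oplus a (orth a) = some 1 :=
  (existsUnique_orth a).choose_spec.1

theorem eq_orth {a b : E} (h : oplus a b = some 1) : b = orth a :=
  (existsUnique_orth a).choose_spec.2 b h

theorem orth_orth (a : E) : orth (orth a) = a :=
  (eq_orth (oplus_comm' _ _ _ (oplus_orth a))).symm

theorem orth_one : orth (1 : E) = 0 :=
  eq_zero_of_oplus_one _ _ (oplus_comm' _ _ _ (oplus_orth 1))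

theorem oplus_assoc_left {a b c f e : E} (h1 : oplus b c = some f) (h2 : oplus a f = some e) :
    ∃ d, oplus a b = some d ∧ oplus d c = some e := by
  obtain ⟨d, hd, hd'⟩ := oplus_assoc' c b a f e (oplus_comm' _ _ _ h1) (oplus_comm' _ _ _ h2)
  exact ⟨d, oplus_comm' _ _ _ hd, oplus_comm' _ _ _ hd'⟩

theorem oplus_zero (a : E) : oplus a 0 = some a := by
  have h10 : oplus (1 : E) 0 = some 1 := by
    have := oplus_orth (1 : E)
    rwa [orth_one] at this
  obtain ⟨f, hf, hf'⟩ :=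
    oplus_assoc' _ _ _ _ _ (oplus_comm' _ _ _ (oplus_orth a)) h10
  have : f = a := by
    rw [eq_orth hf', orth_orth]
  rwa [this] at hf

theorem zero_oplus (a : E) : oplus 0 a = some a := oplus_comm' _ _ _ (oplus_zero a)

theorem oplus_cancel {a b c x : E} (h1 : oplus a b = some x) (h2 : oplus a c = some x) :
    b = c := by
  have key : ∀ y : E, oplus a y = some x → ∃ f, oplus a (orth x) = some f ∧ y = orth f := by
    intro y hy
    obtain ⟨f, hf, hf'⟩ := oplus_assoc' _ _ _ _ _ (oplus_comm' _ _ _ hy) (oplus_orth x)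
    exact ⟨f, hf, eq_orth (oplus_comm' _ _ _ hf')⟩
  obtain ⟨f, hf, rfl⟩ := key b h1
  obtain ⟨g, hg, rfl⟩ := key c h2
  rw [hf] at hg
  rw [Option.some.inj hg]

theorem eq_zero_of_oplus_eq_zero {a b : E} (h : oplus a b = some 0) : b = 0 := by
  obtain ⟨f, hf, -⟩ := oplus_assoc' _ _ _ _ _ h (zero_oplus (1 : E))
  exact eq_zero_of_oplus_one _ _ hf

theorem oplus_swap {a b c d s t w : E} (h1 : oplus a b = some s) (h2 : oplus c d = some t)
    (h3 : oplus s t = some w) :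
    ∃ u v, oplus a c = some u ∧ oplus b d = some v ∧ oplus u v = some w := by
  obtain ⟨f, hf, hf'⟩ := oplus_assoc' _ _ _ _ _ h1 h3
  obtain ⟨g, hg, hg'⟩ := oplus_assoc_left h2 hf
  obtain ⟨v, hv, hv'⟩ := oplus_assoc' _ _ _ _ _ (oplus_comm' _ _ _ hg) hg'
  obtain ⟨u, hu, hu'⟩ := oplus_assoc_left hv' hf'
  exact ⟨u, v, hu, hv, hu'⟩

/-- `a ≤ b` iff `a ⊕ c = b` for some `c`. -/
instance instPartialOrder : PartialOrder E where
  le a b := ∃ c, oplus a c = some b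
  le_refl a := ⟨0, oplus_zero a⟩
  le_trans := by
    rintro a b c ⟨x, hx⟩ ⟨y, hy⟩
    obtain ⟨f, -, hf⟩ := oplus_assoc' _ _ _ _ _ hx hy
    exact ⟨f, hf⟩
  le_antisymm := by
    rintro a b ⟨x, hx⟩ ⟨y, hy⟩
    obtain ⟨f, hf, hf'⟩ := oplus_assoc' _ _ _ _ _ hx hy
    have h0 : f = 0 := oplus_cancel hf' (oplus_zero a)
    subst h0
    have hx0 : x = 0 := eq_zero_of_oplus_eq_zero (oplus_comm' _ _ _ hf)
    subst hx0
    rw [oplus_zero] at hx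
    exact Option.some.inj hx

theorem le_orth_of_oplus {a p s : E} (h : oplus a p = some s) : a ≤ orth p := by
  obtain ⟨f, hf, hf'⟩ := oplus_assoc' _ _ _ _ _ (oplus_comm' _ _ _ h) (oplus_orth s)
  exact ⟨orth s, by rw [hf, eq_orth hf']⟩

end basic

/-- The partial sum `f 0 ⊕ ⋯ ⊕ f (n - 1)` (`none` if it is undefined). -/
def sumTo {E : Type*} [EffectAlgebra E] (f : ℕ → E) : ℕ → Option E
  | 0 => some 0
  | n + 1 => (sumTo f n).bind fun s => oplus s (f n)

/-- `E` is archimedean: if `n a` is defined for every `n`, then `a = 0`. -/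
def IsArchimedean (E : Type*) [EffectAlgebra E] : Prop :=
  ∀ a : E, (∀ n : ℕ, ∃ s, sumTo (fun _ => a) n = some s) → a = 0

/-- Mackey compatibility `a ↔ b`. -/
def Mackey {E : Type*} [EffectAlgebra E] (a b : E) : Prop :=
  ∃ a₁ b₁ c d e : E, oplus a₁ b₁ = some d ∧ oplus d c = some e ∧
    oplus a₁ c = some a ∧ oplus b₁ c = some b

/-- Additive maps. -/
def IsAdditive {E F : Type*} [EffectAlgebra E] [EffectAlgebra F] (f : E → F) : Prop :=
  ∀ a b c : E, oplus a b = some c → oplus (f a) (f b) = some (f c)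

def IsRetraction {E : Type*} [EffectAlgebra E] (J : E → E) : Prop :=
  IsAdditive J ∧ ∀ a, a ≤ J 1 → J a = a

def IsCompression {E : Type*} [EffectAlgebra E] (J : E → E) : Prop :=
  IsRetraction J ∧ ∀ a, J a = 0 ↔ a ≤ orth (J 1)

/-- A chosen element with property `p`; used only for properties that determine the element. -/
noncomputable def the {E : Type*} [EffectAlgebra E] (p : E → Prop) : E :=
  @Classical.epsilon E ⟨0⟩ p

/-- The difference `b ⊖ a`, for `a ≤ b`. -/
noncomputable def ominus {E : Type*} [EffectAlgebra E] (b a : E) : E :=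
  the fun c => oplus a c = some b

/-- The infimum `a ∧ b` in `E`, when it exists. -/
noncomputable def meet {E : Type*} [EffectAlgebra E] (a b : E) : E :=
  the fun c => IsGLB {a, b} c

end EffectAlgebra

open EffectAlgebra

/-- A sub-effect algebra of `E`. -/
structure SubEffectAlgebra (E : Type*) [EffectAlgebra E] where
  carrier : Set E
  zero_mem : (0 : E) ∈ carrier
  one_mem : (1 : E) ∈ carrier
  orth_mem : ∀ a ∈ carrier, orth a ∈ carrier
  oplus_mem : ∀ a ∈ carrier, ∀ b ∈ carrier, ∀ c, oplus a b = some c → c ∈ carrier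

namespace SubEffectAlgebra

instance {E : Type*} [EffectAlgebra E] : SetLike (SubEffectAlgebra E) E where
  coe := carrier
  coe_injective := by
    rintro ⟨⟩ ⟨⟩ h
    congr

/-- The partial addition of a sub-effect algebra is that of `E`. -/
def add {E : Type*} [EffectAlgebra E] (F : SubEffectAlgebra E) (x y : F) : Option F :=
  (oplus (x : E) (y : E)).pmap (fun c (hc : c ∈ F) => ⟨c, hc⟩)
    (fun c hc => F.oplus_mem x x.2 y y.2 c hc)

theorem add_eq_some {E : Type*} [EffectAlgebra E] (F : SubEffectAlgebra E) (x y z : F) :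
    F.add x y = some z ↔ oplus (x : E) (y : E) = some (z : E) := by
  unfold add
  rw [Option.pmap_eq_some_iff]
  constructor
  · rintro ⟨a, ha, h, rfl⟩
    exact h
  · intro h
    exact ⟨z, z.2, h, rfl⟩

instance {E : Type*} [EffectAlgebra E] (F : SubEffectAlgebra E) : EffectAlgebra F where
  zero := ⟨0, F.zero_mem⟩
  one := ⟨1, F.one_mem⟩
  oplus := F.add
  oplus_comm' a b c h := by
    rw [add_eq_some] at h ⊢
    exact oplus_comm' _ _ _ h
  oplus_assoc' a b c d e h1 h2 := by
    rw [add_eq_some] at h1 h2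
    obtain ⟨f, hf, hf'⟩ := EffectAlgebra.oplus_assoc' _ _ _ _ _ h1 h2
    exact ⟨⟨f, F.oplus_mem b b.2 c c.2 f hf⟩, (add_eq_some F _ _ _).2 hf,
      (add_eq_some F _ _ _).2 hf'⟩
  existsUnique_orth a := by
    refine ⟨⟨orth (a : E), F.orth_mem a a.2⟩, (add_eq_some F _ _ _).2 (oplus_orth (a : E)), ?_⟩
    intro y hy
    exact Subtype.ext (eq_orth ((add_eq_some F _ _ _).1 hy))
  eq_zero_of_oplus_one a b h :=
    Subtype.ext (eq_zero_of_oplus_one _ _ ((add_eq_some F _ _ _).1 h))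

theorem oplus_eq_some {E : Type*} [EffectAlgebra E] (F : SubEffectAlgebra E) (x y z : F) :
    oplus x y = some z ↔ oplus (x : E) (y : E) = some (z : E) :=
  add_eq_some F x y z

end SubEffectAlgebra

/-! ### The universal group of an effect algebra -/

/-- The abelian group generated by the elements of `F` subject to `a + b = c` whenever
`a ⊕ b = c` in `F`. -/
abbrev UnivGroup (F : Type*) [EffectAlgebra F] : Type _ :=
  FreeAbelianGroup F ⧸ AddSubgroup.closure
    {x : FreeAbelianGroup F | ∃ a b c : F, oplus a b = some c ∧
      x = FreeAbelianGroup.of a + FreeAbelianGroup.of b - FreeAbelianGroup.of c}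

namespace UnivGroup

/-- The canonical map from `F` to its universal group. -/
def of {F : Type*} [EffectAlgebra F] (a : F) : UnivGroup F :=
  QuotientAddGroup.mk (FreeAbelianGroup.of a)

/-- The positive cone of the universal group, generated by the image of `F`. -/
def posCone (F : Type*) [EffectAlgebra F] : AddSubmonoid (UnivGroup F) :=
  AddSubmonoid.closure (Set.range of)

theorem of_add {F : Type*} [EffectAlgebra F] {a b c : F} (h : oplus a b = some c) :
    of a + of b = of c := by
  unfold of
  rw [← QuotientAddGroup.mk_add, QuotientAddGroup.eq]
  have : -(FreeAbelianGroup.of a + FreeAbelianGroup.of b) + FreeAbelianGroup.of c =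
      -(FreeAbelianGroup.of a + FreeAbelianGroup.of b - FreeAbelianGroup.of c) := by abel
  rw [this]
  exact neg_mem (AddSubgroup.subset_closure ⟨a, b, c, h, rfl⟩)

/-- The endomorphism of the universal group that extends an additive map `f : F → F`. -/
def extend {F : Type*} [EffectAlgebra F] (f : F → F) (hf : IsAdditive f) :
    UnivGroup F →+ UnivGroup F :=
  QuotientAddGroup.lift _ (FreeAbelianGroup.lift fun a => of (f a)) <| by
    rw [AddSubgroup.closure_le]
    rintro _ ⟨a, b, c, h, rfl⟩
    simp [← of_add (hf a b c h)]

theorem extend_of {F : Type*} [EffectAlgebra F] (f : F → F) (hf : IsAdditive f) (a : F) :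
    extend f hf (of a) = of (f a) := by
  simp [extend, of]

end UnivGroup

/-! ### Compression bases and spectrality -/

/-- A compression base `(J_p)_{p ∈ P}`; the values of `J` at indices outside `P` are irrelevant. -/
structure CompressionBase (E : Type*) [EffectAlgebra E] where
  P : SubEffectAlgebra E
  J : E → E → E
  compression : ∀ p ∈ P, IsCompression (J p)
  focus : ∀ p ∈ P, J p 1 = p
  comp : ∀ p ∈ P, ∀ q ∈ P, Mackey p q → ∃ r ∈ P, J p ∘ J q = J r

namespace CompressionBase

section defs

variable {E : Type*} [EffectAlgebra E] (𝒥 : CompressionBase E)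

/-- The commutant `C(p)` of a projection `p`. -/
def commutant (p : E) : Set E :=
  {a | oplus (𝒥.J p a) (𝒥.J (orth p) a) = some a}

/-- `PC(A)`: the projections `p` with `A ⊆ C(p)`. -/
def PC (A : Set E) : Set E :=
  {p | p ∈ 𝒥.P ∧ ∀ a ∈ A, a ∈ 𝒥.commutant p}

/-- The bicommutant `P(A) = PC(PC(A) ∪ A)`. -/
def bicommutant (A : Set E) : Set E :=
  𝒥.PC (𝒥.PC A ∪ A)

/-- `B` is a Boolean subalgebra of `P`: a sub-effect algebra contained in `P` which is a Boolean
algebra for the order and the orthosupplement of `E`. -/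
def IsBooleanSubalgebra.{u} {E : Type u} [EffectAlgebra E] (𝒥 : CompressionBase E)
    (B : SubEffectAlgebra E) : Prop :=
  (∀ b ∈ B, b ∈ 𝒥.P) ∧
    ∃ (β : Type u) (_ : BooleanAlgebra β) (f : β ↪o E),
      Set.range f = (B : Set E) ∧ ∀ x, f xᶜ = orth (f x)

/-- The b-property. -/
def HasBProperty : Prop :=
  ∀ a : E, ∃ B : SubEffectAlgebra E, 𝒥.IsBooleanSubalgebra B ∧
    ∀ p ∈ 𝒥.P, a ∈ 𝒥.commutant p ↔ (B : Set E) ⊆ 𝒥.commutant p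

/-- `e` and `f` commute: `P(e) ↔ P(f)`. -/
def Commutes (e f : E) : Prop :=
  ∀ p ∈ 𝒥.bicommutant {e}, ∀ q ∈ 𝒥.bicommutant {f}, Mackey p q

/-- The set `P_≤(e, f)`. -/
def Ple (e f : E) : Set E :=
  {p | p ∈ 𝒥.bicommutant {e, f} ∧ 𝒥.J p e ≤ 𝒥.J p f ∧
    𝒥.J (orth p) f ≤ 𝒥.J (orth p) e}

def HasBComparability : Prop :=
  𝒥.HasBProperty ∧ ∀ e f : E, 𝒥.Commutes e f → (𝒥.Ple e f).Nonempty

/-- `p` is a projection cover of `a`. -/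
def IsCover (a p : E) : Prop :=
  p ∈ 𝒥.P ∧ ∀ q ∈ 𝒥.P, a ≤ q ↔ p ≤ q

def HasProjectionCovers : Prop :=
  ∀ a : E, ∃ p, 𝒥.IsCover a p

/-- `E` is spectral (with respect to the given compression base). -/
def IsSpectral : Prop :=
  𝒥.HasBComparability ∧ 𝒥.HasProjectionCovers

/-! ### The binary spectral resolution -/

/-- The projection cover `a°`. -/
noncomputable def cover (a : E) : E := the (𝒥.IsCover a)

/-- The positive part `(b - a)_+ = J_p(b) ⊖ J_p(a)`, for any `p ∈ P_≤(a, b)`. -/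
noncomputable def posDiff (b a : E) : E :=
  the fun x => ∃ p ∈ 𝒥.Ple a b, oplus (𝒥.J p a) x = some (𝒥.J p b)

/-- The projection `u_{w0}` obtained from `c = c_w` and `u = u_w`. -/
noncomputable def splitU0 (c u : E) : E :=
  meet (orth (𝒥.cover (𝒥.posDiff c (orth c)))) u

/-- The projection `u_{w1}`. -/
noncomputable def splitU1 (c u : E) : E :=
  meet u (orth (𝒥.splitU0 c u))

/-- The element `c_{w0}`. -/
noncomputable def splitC0 (c u : E) : E :=
  ominus (𝒥.splitU0 c u) (meet (𝒥.posDiff (orth c) c) u)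

/-- The element `c_{w1}`. -/
noncomputable def splitC1 (c u : E) : E :=
  meet (𝒥.posDiff c (orth c)) u

/-- The pair `(c_w, u_w)`. The binary string `w = w_1 ⋯ w_n` is encoded by its length `n` and by
the number `k = ∑ w_j 2^(n-j) < 2^n`; so `w0` and `w1` are encoded by `(n + 1, 2 k)` and
`(n + 1, 2 k + 1)`, and the lexicographic order on strings of length `n` is the order of `k`. -/
noncomputable def cu (a : E) : ℕ → ℕ → E × E
  | 0, _ => (a, 𝒥.cover a)
  | n + 1, k =>
    let c := (cu a n (k / 2)).1
    let u := (cu a n (k / 2)).2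
    if k % 2 = 0 then (𝒥.splitC0 c u, 𝒥.splitU0 c u) else (𝒥.splitC1 c u, 𝒥.splitU1 c u)

/-- The binary spectral projection `p_{a,μ}` for a dyadic `μ ∈ [0, 1]`. A dyadic `μ ∈ (0, 1)` has
the reduced form `μ = (2 k + 1) / 2^(n + 1)`, and then `p_{a,μ}` is the sum of `(a°)'` and of all
`u_w` with `w` of length `n + 1` and number at most `2 k`. -/
noncomputable def binaryProj (a : E) (μ : ℚ) : E :=
  if μ = 0 then orth (𝒥.cover a)
  else if μ = 1 then 1
  else the fun p => ∃ s, sumTo (fun j => (𝒥.cu a (Nat.log 2 μ.den) j).2) μ.num.toNat = some s ∧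
    oplus (orth (𝒥.cover a)) s = some p

end defs

/-! ### Blocks, C-blocks, and spectral projections in the universal group of a C-block -/

section compat

variable {E : Type*} [EffectAlgebra E]

theorem mackey_symm {a b : E} (h : Mackey a b) : Mackey b a := by
  obtain ⟨x, y, c, d, e, h1, h2, h3, h4⟩ := h
  exact ⟨y, x, c, d, e, oplus_comm' _ _ _ h1, h2, h4, h3⟩

theorem mackey_refl (a : E) : Mackey a a :=
  ⟨0, 0, a, 0, a, oplus_zero 0, zero_oplus a, zero_oplus a, zero_oplus a⟩

variable (𝒥 : CompressionBase E)

theorem additive {p : E} (hp : p ∈ 𝒥.P) : IsAdditive (𝒥.J p) := (𝒥.compression p hp).1.1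

theorem J_of_le {p a : E} (hp : p ∈ 𝒥.P) (h : a ≤ p) : 𝒥.J p a = a :=
  (𝒥.compression p hp).1.2 a (by rwa [𝒥.focus p hp])

theorem J_of_le_orth {p a : E} (hp : p ∈ 𝒥.P) (h : a ≤ orth p) : 𝒥.J p a = 0 :=
  ((𝒥.compression p hp).2 a).2 (by rwa [𝒥.focus p hp])

theorem orth_mem {p : E} (hp : p ∈ 𝒥.P) : orth p ∈ 𝒥.P := 𝒥.P.orth_mem p hp

theorem J_of_decomp {p a a₁ c s : E} (hp : p ∈ 𝒥.P) (h1 : oplus a₁ p = some s) (h2 : c ≤ p)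
    (h3 : oplus a₁ c = some a) : 𝒥.J p a = c := by
  have := 𝒥.additive hp _ _ _ h3
  rw [𝒥.J_of_le_orth hp (le_orth_of_oplus h1), 𝒥.J_of_le hp h2, zero_oplus] at this
  exact (Option.some.inj this).symm

theorem mackey_decomp {a p : E} (h : Mackey a p) :
    ∃ a₁ c s, oplus a₁ p = some s ∧ c ≤ p ∧ oplus a₁ c = some a := by
  obtain ⟨x, y, c, d, e, h1, h2, h3, h4⟩ := h
  obtain ⟨f, hf, hf'⟩ := oplus_assoc' _ _ _ _ _ h1 h2
  rw [h4] at hf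
  obtain rfl := Option.some.inj hf
  exact ⟨x, c, e, hf', ⟨y, oplus_comm' _ _ _ h4⟩, h3⟩

theorem mem_commutant_of_mackey {a p : E} (hp : p ∈ 𝒥.P) (h : Mackey a p) :
    a ∈ 𝒥.commutant p := by
  obtain ⟨a₁, c, s, h1, h2, h3⟩ := mackey_decomp h
  have e1 : 𝒥.J p a = c := 𝒥.J_of_decomp hp h1 h2 h3
  have e2 : 𝒥.J (orth p) a = a₁ := by
    have := 𝒥.additive (𝒥.orth_mem hp) _ _ _ h3
    rw [𝒥.J_of_le (𝒥.orth_mem hp) (le_orth_of_oplus h1),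
      𝒥.J_of_le_orth (𝒥.orth_mem hp) (by rwa [orth_orth]), oplus_zero] at this
    exact (Option.some.inj this).symm
  simp only [commutant, Set.mem_ofPred_eq]
  rw [e1, e2]
  exact oplus_comm' _ _ _ h3

theorem mackey_of_mem_commutant {a p : E} (hp : p ∈ 𝒥.P) (h : a ∈ 𝒥.commutant p) :
    Mackey a p := by
  have hp' := 𝒥.orth_mem hp
  have h1 := 𝒥.additive hp _ _ _ (oplus_orth a)
  have h2 := 𝒥.additive hp' _ _ _ (oplus_orth a)
  rw [𝒥.focus p hp] at h1
  rw [𝒥.focus _ hp'] at h2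
  obtain ⟨z, hz, -⟩ := oplus_assoc_left h2 (oplus_orth p)
  have h1' := oplus_comm' _ _ _ h1
  obtain ⟨d, hd, hd'⟩ := oplus_assoc_left h1' (oplus_comm' _ _ _ hz)
  exact ⟨_, _, _, d, z, hd, hd', oplus_comm' _ _ _ h, h1'⟩

theorem mackey_orth {p q : E} (hp : p ∈ 𝒥.P) (h : Mackey q p) :
    Mackey q (orth p) := by
  refine 𝒥.mackey_of_mem_commutant (𝒥.orth_mem hp) ?_
  have := 𝒥.mem_commutant_of_mackey hp h
  simp only [commutant, Set.mem_ofPred_eq] at this ⊢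
  rw [orth_orth]
  exact oplus_comm' _ _ _ this

theorem J_comm {p q : E} (hp : p ∈ 𝒥.P) (hq : q ∈ 𝒥.P) (h : Mackey p q) (a : E) :
    𝒥.J p (𝒥.J q a) = 𝒥.J q (𝒥.J p a) := by
  obtain ⟨r, hr, hr'⟩ := 𝒥.comp p hp q hq h
  obtain ⟨s, hs, hs'⟩ := 𝒥.comp q hq p hp (mackey_symm h)
  have er : 𝒥.J p q = r := by
    have := congrFun hr' 1
    rwa [Function.comp_apply, 𝒥.focus q hq, 𝒥.focus r hr] at this
  have es : 𝒥.J q p = s := by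
    have := congrFun hs' 1
    rwa [Function.comp_apply, 𝒥.focus p hp, 𝒥.focus s hs] at this
  obtain ⟨x, y, c, d, e, h1, h2, h3, h4⟩ := h
  have e1 : 𝒥.J q p = c := by
    obtain ⟨f, hf, hf'⟩ := oplus_assoc' _ _ _ _ _ h1 h2
    rw [h4] at hf
    obtain rfl := Option.some.inj hf
    exact 𝒥.J_of_decomp hq hf' ⟨y, oplus_comm' _ _ _ h4⟩ h3
  have e2 : 𝒥.J p q = c := by
    obtain ⟨f, hf, hf'⟩ := oplus_assoc' _ _ _ _ _ (oplus_comm' _ _ _ h1) h2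
    rw [h3] at hf
    obtain rfl := Option.some.inj hf
    exact 𝒥.J_of_decomp hp hf' ⟨x, oplus_comm' _ _ _ h3⟩ h4
  have : r = s := by rw [← er, ← es, e1, e2]
  have e3 := congrFun hr' a
  have e4 := congrFun hs' a
  simp only [Function.comp_apply] at e3 e4
  rw [e3, e4, this]

end compat

/-- A block of `P`: a maximal set of pairwise Mackey compatible projections. -/
structure Block {E : Type*} [EffectAlgebra E] (𝒥 : CompressionBase E) where
  carrier : Set E
  maximal : Maximal
    (fun S : Set E => S ⊆ (𝒥.P : Set E) ∧ ∀ p ∈ S, ∀ q ∈ S, Mackey p q) carrier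

namespace Block

variable {E : Type*} [EffectAlgebra E] {𝒥 : CompressionBase E} (B : 𝒥.Block)

theorem proj {p : E} (hp : p ∈ B.carrier) : p ∈ 𝒥.P := B.maximal.prop.1 hp

theorem orth_mem {p : E} (hp : p ∈ B.carrier) : orth p ∈ B.carrier := by
  refine B.maximal.le_of_ge (y := insert (orth p) B.carrier) ⟨?_, ?_⟩
    (Set.subset_insert _ _) (Set.mem_insert _ _)
  · rintro x (rfl | hx)
    · exact 𝒥.orth_mem (B.proj hp)
    · exact B.proj hx
  · have key : ∀ q ∈ B.carrier, Mackey q (orth p) := fun q hq =>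
      𝒥.mackey_orth (B.proj hp) (B.maximal.prop.2 q hq p hp)
    rintro x (rfl | hx) y (rfl | hy)
    · exact mackey_refl _
    · exact mackey_symm (key y hy)
    · exact key x hx
    · exact B.maximal.prop.2 x hx y hy

/-- The orthosupplement on a block. -/
noncomputable def compl (p : B.carrier) : B.carrier := ⟨orth p, B.orth_mem p.2⟩

/-- The C-block `C(B)`: the set of all `a ∈ E` with `a ∈ C(p)` for every `p ∈ B`. -/
def cblock : SubEffectAlgebra E where
  carrier := {a | ∀ p ∈ B.carrier, a ∈ 𝒥.commutant p}
  one_mem := by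
    intro p hp
    have h := B.proj hp
    simp only [commutant, Set.mem_ofPred_eq]
    rw [𝒥.focus p h, 𝒥.focus _ (𝒥.orth_mem h)]
    exact oplus_orth p
  zero_mem := by
    intro p hp
    have h := B.proj hp
    have h0 : ∀ x : E, (0 : E) ≤ x := fun x => ⟨x, zero_oplus x⟩
    simp only [commutant, Set.mem_ofPred_eq]
    rw [𝒥.J_of_le h (h0 _), 𝒥.J_of_le (𝒥.orth_mem h) (h0 _)]
    exact oplus_zero 0
  orth_mem := by
    intro a ha p hp
    have h := B.proj hp
    have h1 := 𝒥.additive h _ _ _ (oplus_orth a)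
    have h2 := 𝒥.additive (𝒥.orth_mem h) _ _ _ (oplus_orth a)
    rw [𝒥.focus p h] at h1
    rw [𝒥.focus _ (𝒥.orth_mem h)] at h2
    obtain ⟨u, v, hu, hv, huv⟩ := oplus_swap h1 h2 (oplus_orth p)
    have hap : oplus (𝒥.J p a) (𝒥.J (orth p) a) = some a := ha p hp
    rw [hap] at hu
    obtain rfl := Option.some.inj hu
    rw [← eq_orth huv] at *
    exact hv
  oplus_mem := by
    intro a ha b hb c hc p hp
    have h := B.proj hp
    have h1 := 𝒥.additive h _ _ _ hc
    have h2 := 𝒥.additive (𝒥.orth_mem h) _ _ _ hc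
    obtain ⟨u, v, hu, hv, huv⟩ := oplus_swap (ha p hp) (hb p hp) hc
    rw [h1] at hu
    rw [h2] at hv
    obtain rfl := Option.some.inj hu
    obtain rfl := Option.some.inj hv
    exact huv

theorem J_mem {p : E} (hp : p ∈ B.carrier) {a : E} (ha : a ∈ B.cblock) :
    𝒥.J p a ∈ B.cblock := by
  intro q hq
  have hP := B.proj hp
  have hQ := B.proj hq
  have := 𝒥.additive hP _ _ _ (ha q hq)
  rw [𝒥.J_comm hP hQ (B.maximal.prop.2 p hp q hq),
    𝒥.J_comm hP (𝒥.orth_mem hQ) (B.maximal.prop.2 p hp _ (B.orth_mem hq))] at this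
  exact this

/-- The compression `J_p` restricted to the C-block, for `p ∈ B`. -/
def restrict (p : B.carrier) (a : B.cblock) : B.cblock :=
  ⟨𝒥.J p a, B.J_mem p.2 a.2⟩

theorem restrict_additive (p : B.carrier) : IsAdditive (B.restrict p) := by
  intro a b c h
  rw [SubEffectAlgebra.oplus_eq_some] at h ⊢
  exact 𝒥.additive (B.proj p.2) _ _ _ h

/-- The extension of the restricted compression to the universal group of the C-block. -/
def compr (p : B.carrier) : UnivGroup B.cblock →+ UnivGroup B.cblock :=
  UnivGroup.extend (B.restrict p) (B.restrict_additive p)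

/-- `x` is the positive part `g_+` of `g`: there is an orthogonal decomposition `g = x - y`. -/
def IsPosPart (g x : UnivGroup B.cblock) : Prop :=
  ∃ y, x ∈ UnivGroup.posCone B.cblock ∧ y ∈ UnivGroup.posCone B.cblock ∧ g = x - y ∧
    ∃ p : B.carrier, B.compr p g = x ∧ B.compr (B.compl p) g = -y

/-- `r` is the value `g^*` of the Rickart mapping at `g`: for all `p ∈ B`, `p ≤ r` iff
`g` is compatible with `p` and `J_p(g) = 0`. -/
def IsRickart (g : UnivGroup B.cblock) (r : E) : Prop :=
  r ∈ B.carrier ∧ ∀ p : B.carrier, (p : E) ≤ r ↔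
    g = B.compr p g + B.compr (B.compl p) g ∧ B.compr p g = 0

/-- `r = ((n a - m 1)_+)^*`, computed in the universal group of the C-block; that is,
`r` is the spectral projection of `a` in the C-block at `m / n`. -/
def IsSpectralProj (a : B.cblock) (m : ℤ) (n : ℕ) (r : E) : Prop :=
  ∃ x, B.IsPosPart (n • UnivGroup.of a - m • UnivGroup.of 1) x ∧ B.IsRickart x r

end Block

end CompressionBase

/-! Fix a block $B$ with $a\in C=C(B)$. The block is a Boolean algebra with meet $J_p(q)$; its
ultrafilters $\chi$ serve as points. At $\chi$, identify elements of $C$ that agree under some $J_p$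
with $p\in\chi$. Comparability makes the quotient a totally ordered effect algebra, and such a chain
embeds in a linearly ordered abelian group: formal sums $n+t$ with $n\in\mathbb Z$ and $t<1$ in the
chain, added with carry. So elements of $C$ become functions on the points, and by comparability and
projection covers the pointwise order is the order of $C$ (`le_of_val`).

Everything can now be read pointwise. A projection of $B$ is a set of points, and $a^\circ$ is
$\{a>0\}$. The projection $((na-m1)_+)^*$ is $\{na\le m1\}$ (`exists_isSpectralProj_iff`); here the
positive part must first be produced in the universal group (`exists_splits`). The projection $u_w$
is $\{k1<2^na\le(k+1)1\}$ (`cu_spec`), hence the binary projection at $k/2^l$ is $\{2^la\le k1\}$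
(`binaryProj_spec`).

Clearly $\{na\le m1\}$ lies in every $\{2^la\le k1\}$ with $k/2^l>m/n$. The values may contain
infinitesimals, so the converse is not pointwise: it needs the archimedean property, used only in
`isGLB_binaryProj`. A lower bound in $E$, which need not lie in $C$, has a cover $q$, and all
multiples of $J_q((na-m1)_+\wedge 1)$ exist, so this element is $0$. Finally, the binary projections
do not mention a block, so their infimum gives independence of $C$ as well as uniqueness. -/

namespace EffectAlgebra

/-! ### Order and cancellation in effect algebras. -/

section order

variable {E : Type*} [EffectAlgebra E] {a b c x y z : E}

theorem le_of_oplus (h : oplus a b = some c) : a ≤ c := ⟨b, h⟩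

theorem le_of_oplus' (h : oplus a b = some c) : b ≤ c := ⟨a, oplus_comm' _ _ _ h⟩

theorem zero_le' (a : E) : 0 ≤ a := ⟨a, zero_oplus a⟩

theorem le_one' (a : E) : a ≤ 1 := ⟨orth a, oplus_orth a⟩

theorem eq_zero_of_le_zero (h : a ≤ 0) : a = 0 := le_antisymm h (zero_le' a)

theorem oplus_inj (h1 : oplus a b = some x) (h2 : oplus a b = some y) : x = y :=
  Option.some.inj (h1.symm.trans h2)

theorem oplus_cancel_right (h1 : oplus b a = some x) (h2 : oplus c a = some x) : b = c :=
  oplus_cancel (oplus_comm' _ _ _ h1) (oplus_comm' _ _ _ h2)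

theorem orth_oplus (a : E) : oplus (orth a) a = some 1 := oplus_comm' _ _ _ (oplus_orth a)

theorem exists_oplus_of_le_orth (h : a ≤ orth b) : ∃ s, oplus a b = some s := by
  obtain ⟨c, hc⟩ := h
  obtain ⟨d, hd, -⟩ := oplus_assoc_left hc (oplus_orth b)
  exact ⟨d, oplus_comm' _ _ _ hd⟩

theorem orth_le_orth (h : a ≤ b) : orth b ≤ orth a := by
  obtain ⟨c, hc⟩ := h
  obtain ⟨f, hf, hf'⟩ := oplus_assoc' _ _ _ _ _ hc (oplus_orth b)
  rw [← eq_orth hf']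
  exact le_of_oplus' hf

theorem le_orth_comm (h : a ≤ orth b) : b ≤ orth a := by
  have := orth_le_orth h
  rwa [orth_orth] at this

/-- If `a ⊕ b = c`, then `c' ⊕ a = b'`. -/
theorem orth_oplus_of_oplus (h : oplus a b = some c) : oplus (orth c) a = some (orth b) := by
  obtain ⟨f, hf, hf'⟩ := oplus_assoc' _ _ _ _ _ (oplus_comm' _ _ _ h) (oplus_orth c)
  rw [← eq_orth hf']
  exact oplus_comm' _ _ _ hf

theorem IsAdditive.map_zero {F : Type*} [EffectAlgebra F] {f : E → F} (hf : IsAdditive f) :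
    f 0 = 0 := oplus_cancel (hf _ _ _ (oplus_zero 0)) (oplus_zero _)

theorem IsAdditive.mono {F : Type*} [EffectAlgebra F] {f : E → F} (hf : IsAdditive f)
    (h : a ≤ b) : f a ≤ f b := by
  obtain ⟨c, hc⟩ := h
  exact ⟨f c, hf _ _ _ hc⟩

theorem the_eq {p : E → Prop} (h : p a) (hu : ∀ x, p x → x = a) : the p = a :=
  hu _ (Classical.epsilon_spec (⟨a, h⟩ : ∃ x, p x))

theorem ominus_eq (h : oplus a c = some b) : ominus b a = c :=
  the_eq h fun _ hx => oplus_cancel hx h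

theorem meet_eq (h : IsGLB {a, b} c) : meet a b = c :=
  the_eq h fun _ hx => hx.unique h

theorem sumTo_map {F : Type*} [EffectAlgebra F] {f : E → F} (hf : IsAdditive f) (g : ℕ → E)
    (n : ℕ) (h : sumTo g n = some a) : sumTo (fun k => f (g k)) n = some (f a) := by
  induction n generalizing a with
  | zero =>
    obtain rfl : 0 = a := Option.some.inj h
    rw [hf.map_zero]
    rfl
  | succ n ih =>
    simp only [sumTo, Option.bind_eq_some_iff] at h ⊢
    obtain ⟨s, hs, hs'⟩ := h
    exact ⟨_, ih hs, hf _ _ _ hs'⟩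

theorem eq_zero_of_oplus_of_oplus {d : E} (h1 : oplus a b = some c) (h2 : oplus c d = some b) : a = 0 := by
  obtain rfl : c = b := le_antisymm (le_of_oplus h2) (le_of_oplus' h1)
  exact oplus_cancel_right h1 (zero_oplus c)

end order

end EffectAlgebra

theorem SubEffectAlgebra.mem_of_oplus {E : Type*} [EffectAlgebra E] (F : SubEffectAlgebra E)
    {a b c : E} (ha : a ∈ F) (hc : c ∈ F) (h : oplus a b = some c) : b ∈ F := by
  have h1 := F.orth_mem _ (F.oplus_mem _ (F.orth_mem _ hc) _ ha _ (orth_oplus_of_oplus h))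
  rwa [orth_orth] at h1

namespace CompressionBase

/-! ### Compressions and projection covers. -/

section basic

variable {E : Type*} [EffectAlgebra E] (𝒥 : CompressionBase E) {a b c p q r : E}

theorem J_mono (hp : p ∈ 𝒥.P) (h : a ≤ b) : 𝒥.J p a ≤ 𝒥.J p b := (𝒥.additive hp).mono h

theorem J_zero (hp : p ∈ 𝒥.P) : 𝒥.J p 0 = 0 := (𝒥.additive hp).map_zero

theorem J_le (hp : p ∈ 𝒥.P) (a : E) : 𝒥.J p a ≤ p := by
  have := 𝒥.J_mono hp (le_one' a)
  rwa [𝒥.focus p hp] at this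

theorem J_J (hp : p ∈ 𝒥.P) (a : E) : 𝒥.J p (𝒥.J p a) = 𝒥.J p a := 𝒥.J_of_le hp (𝒥.J_le hp a)

theorem J_orth_J (hp : p ∈ 𝒥.P) (a : E) : 𝒥.J p (𝒥.J (orth p) a) = 0 :=
  𝒥.J_of_le_orth hp (𝒥.J_le (𝒥.orth_mem hp) a)

theorem J_J_orth (hp : p ∈ 𝒥.P) (a : E) : 𝒥.J (orth p) (𝒥.J p a) = 0 := by
  have := 𝒥.J_orth_J (𝒥.orth_mem hp) a
  rwa [orth_orth] at this

theorem J_eq_zero_iff (hp : p ∈ 𝒥.P) : 𝒥.J p a = 0 ↔ a ≤ orth p := by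
  have := (𝒥.compression p hp).2 a
  rwa [𝒥.focus p hp] at this

/-- Projections are principal: $J_p$ fixes both summands, hence their sum, and its values lie below
$p$. -/
theorem oplus_le (hp : p ∈ 𝒥.P) (ha : a ≤ p) (hb : b ≤ p) (h : oplus a b = some c) : c ≤ p := by
  have := 𝒥.additive hp _ _ _ h
  rw [𝒥.J_of_le hp ha, 𝒥.J_of_le hp hb, h] at this
  rw [Option.some.inj this]
  exact 𝒥.J_le hp c

theorem J_le_self (h : a ∈ 𝒥.commutant p) : 𝒥.J p a ≤ a := le_of_oplus h

/-- A common lower bound is fixed by $J_p$, which is monotone. This evaluates every `meet` in the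
binary resolution as a compression. -/
theorem isGLB_J (hp : p ∈ 𝒥.P) (h : a ∈ 𝒥.commutant p) : IsGLB {a, p} (𝒥.J p a) := by
  constructor
  · rintro x (rfl | rfl)
    · exact 𝒥.J_le_self h
    · exact 𝒥.J_le hp a
  · intro x hx
    have h1 : x ≤ a := hx (by simp)
    have h2 : x ≤ p := hx (by simp)
    rw [← 𝒥.J_of_le hp h2]
    exact 𝒥.J_mono hp h1

/-- For projections `q ≤ p`, `J_q` factors through `J_p`. -/
theorem J_J_of_le (hp : p ∈ 𝒥.P) (hq : q ∈ 𝒥.P) (hqp : q ≤ p) (h : a ∈ 𝒥.commutant p) :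
    𝒥.J q (𝒥.J p a) = 𝒥.J q a := by
  have h1 := 𝒥.additive hq _ _ _ h
  rw [𝒥.J_of_le_orth hq ((𝒥.J_le (𝒥.orth_mem hp) a).trans (orth_le_orth hqp)), oplus_zero] at h1
  exact Option.some.inj h1

theorem J_comm_proj (hp : p ∈ 𝒥.P) (hq : q ∈ 𝒥.P) (h : Mackey p q) : 𝒥.J p q = 𝒥.J q p := by
  have := 𝒥.J_comm hp hq h 1
  rwa [𝒥.focus p hp, 𝒥.focus q hq] at this

theorem J_mem_P (hp : p ∈ 𝒥.P) (hq : q ∈ 𝒥.P) (h : Mackey p q) : 𝒥.J p q ∈ 𝒥.P := by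
  obtain ⟨r, hr, hr'⟩ := 𝒥.comp p hp q hq h
  have er := congrFun hr' 1
  rw [Function.comp_apply, 𝒥.focus q hq, 𝒥.focus r hr] at er
  rwa [er]

theorem J_J_eq (hp : p ∈ 𝒥.P) (hq : q ∈ 𝒥.P) (h : Mackey p q) (a : E) :
    𝒥.J (𝒥.J p q) a = 𝒥.J p (𝒥.J q a) := by
  obtain ⟨r, hr, hr'⟩ := 𝒥.comp p hp q hq h
  have er := congrFun hr' 1
  rw [Function.comp_apply, 𝒥.focus q hq, 𝒥.focus r hr] at er
  rw [er, ← hr', Function.comp_apply]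

variable {𝒥}

theorem HasProjectionCovers.isCover (h : 𝒥.HasProjectionCovers) (a : E) :
    𝒥.IsCover a (𝒥.cover a) := Classical.epsilon_spec (h a)

theorem HasProjectionCovers.cover_mem (h : 𝒥.HasProjectionCovers) (a : E) :
    𝒥.cover a ∈ 𝒥.P := (h.isCover a).1

theorem HasProjectionCovers.le_iff (h : 𝒥.HasProjectionCovers) (hq : q ∈ 𝒥.P) :
    a ≤ q ↔ 𝒥.cover a ≤ q := (h.isCover a).2 q hq

theorem HasProjectionCovers.le_cover (h : 𝒥.HasProjectionCovers) (a : E) : a ≤ 𝒥.cover a :=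
  (h.le_iff (h.cover_mem a)).2 le_rfl

/-- The projection cover of `a` belongs to every commutant `C(s)` to which `a` belongs. -/
theorem HasProjectionCovers.cover_mem_commutant (h : 𝒥.HasProjectionCovers) {s : E}
    (hs : s ∈ 𝒥.P) (ha : a ∈ 𝒥.commutant s) : 𝒥.cover a ∈ 𝒥.commutant s := by
  have hs' := 𝒥.orth_mem hs
  have h1 : 𝒥.cover (𝒥.J s a) ≤ s := (h.le_iff hs).1 (𝒥.J_le hs a)
  have h2 : 𝒥.cover (𝒥.J (orth s) a) ≤ orth s := (h.le_iff hs').1 (𝒥.J_le hs' a)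
  have h3 := h.cover_mem a
  -- The covers of $J_s(a)$ and $J_{s'}(a)$ lie below $s$ and $s'$, so they are orthogonal; their
  -- sum is shown to be $a^\circ$, which is thereby split by $s$.
  obtain ⟨t, ht⟩ := exists_oplus_of_le_orth (h1.trans (le_orth_comm h2))
  have htP : t ∈ 𝒥.P := 𝒥.P.oplus_mem _ (h.cover_mem _) _ (h.cover_mem _) _ ht
  have e1 : t ≤ 𝒥.cover a := 𝒥.oplus_le h3
    ((h.le_iff h3).1 ((𝒥.J_le_self ha).trans (h.le_cover a)))
    ((h.le_iff h3).1 ((le_of_oplus' ha).trans (h.le_cover a))) ht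
  have e2 : 𝒥.cover a ≤ t := (h.le_iff htP).1 <| 𝒥.oplus_le htP
    ((h.le_cover _).trans (le_of_oplus ht)) ((h.le_cover _).trans (le_of_oplus' ht)) ha
  have e : t = 𝒥.cover a := le_antisymm e1 e2
  rw [e] at ht
  have h4 := 𝒥.additive hs _ _ _ ht
  have h5 := 𝒥.additive hs' _ _ _ ht
  rw [𝒥.J_of_le hs h1, 𝒥.J_of_le_orth hs h2, oplus_zero] at h4
  rw [𝒥.J_of_le hs' h2, 𝒥.J_of_le_orth hs' (by rwa [orth_orth]), zero_oplus] at h5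
  simp only [commutant, Set.mem_ofPred_eq]
  rwa [← Option.some.inj h4, ← Option.some.inj h5]

theorem cover_zero_of (h : 𝒥.HasProjectionCovers) (ha : 𝒥.cover a = 0) : a = 0 :=
  eq_zero_of_le_zero (ha ▸ h.le_cover a)

end basic

/-! ### Blocks -/

namespace Block

variable {E : Type*} [EffectAlgebra E] {𝒥 : CompressionBase E} (B : 𝒥.Block) {a b c p q r : E}

theorem mackey (hp : p ∈ B.carrier) (hq : q ∈ B.carrier) : Mackey p q :=
  B.maximal.prop.2 p hp q hq

theorem mem_of_mackey (hr : r ∈ 𝒥.P) (h : ∀ p ∈ B.carrier, Mackey r p) : r ∈ B.carrier := by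
  refine B.maximal.le_of_ge (y := insert r B.carrier) ⟨?_, ?_⟩
    (Set.subset_insert _ _) (Set.mem_insert _ _)
  · rintro x (rfl | hx)
    · exact hr
    · exact B.proj hx
  · rintro x (rfl | hx) y (rfl | hy)
    · exact mackey_refl _
    · exact h y hy
    · exact mackey_symm (h x hx)
    · exact B.mackey hx hy

/-- Maximality of the block. Covers, meets and sums are placed in $B$ by this criterion. -/
theorem mem_of_mem_cblock (hr : r ∈ 𝒥.P) (h : r ∈ B.cblock) : r ∈ B.carrier :=
  B.mem_of_mackey hr fun p hp => 𝒥.mackey_of_mem_commutant (B.proj hp) (h p hp)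

theorem mem_cblock (hp : p ∈ B.carrier) : p ∈ B.cblock :=
  fun _ hq => 𝒥.mem_commutant_of_mackey (B.proj hq) (B.mackey hp hq)

theorem one_mem : (1 : E) ∈ B.carrier := B.mem_of_mem_cblock 𝒥.P.one_mem B.cblock.one_mem

theorem zero_mem : (0 : E) ∈ B.carrier := B.mem_of_mem_cblock 𝒥.P.zero_mem B.cblock.zero_mem

theorem J_mem_carrier (hp : p ∈ B.carrier) (hq : q ∈ B.carrier) : 𝒥.J p q ∈ B.carrier :=
  B.mem_of_mem_cblock (𝒥.J_mem_P (B.proj hp) (B.proj hq) (B.mackey hp hq))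
    (B.J_mem hp (B.mem_cblock hq))

theorem oplus_mem_carrier (hp : p ∈ B.carrier) (hq : q ∈ B.carrier) (h : oplus p q = some r) :
    r ∈ B.carrier :=
  B.mem_of_mem_cblock (𝒥.P.oplus_mem _ (B.proj hp) _ (B.proj hq) _ h)
    (B.cblock.oplus_mem _ (B.mem_cblock hp) _ (B.mem_cblock hq) _ h)

theorem J_comm (hp : p ∈ B.carrier) (hq : q ∈ B.carrier) (a : E) :
    𝒥.J p (𝒥.J q a) = 𝒥.J q (𝒥.J p a) :=
  𝒥.J_comm (B.proj hp) (B.proj hq) (B.mackey hp hq) a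

theorem J_J_eq (hp : p ∈ B.carrier) (hq : q ∈ B.carrier) (a : E) :
    𝒥.J (𝒥.J p q) a = 𝒥.J p (𝒥.J q a) :=
  𝒥.J_J_eq (B.proj hp) (B.proj hq) (B.mackey hp hq) a

/-- Every $s\in B$ belongs to $PC(A)$, so a member of $P(A)$ is compatible with all of $B$, and
maximality applies. Thus comparison projections for elements of $C$ stay in $B$, and any two
elements of $C$ commute. -/
theorem bicommutant_subset {A : Set E} (hA : A ⊆ (B.cblock : Set E)) :
    𝒥.bicommutant A ⊆ B.carrier := by
  intro r hr
  refine B.mem_of_mackey hr.1 fun s hs => mackey_symm ?_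
  refine 𝒥.mackey_of_mem_commutant hr.1 (hr.2 s (Or.inl ⟨B.proj hs, ?_⟩))
  exact fun x hx => hA hx s hs

theorem Ple_subset (ha : a ∈ B.cblock) (hb : b ∈ B.cblock) : 𝒥.Ple a b ⊆ B.carrier :=
  fun _ hp => B.bicommutant_subset (by rintro x (rfl | rfl) <;> assumption) hp.1

theorem exists_comparison (hS : 𝒥.IsSpectral) (ha : a ∈ B.cblock) (hb : b ∈ B.cblock) :
    (𝒥.Ple a b).Nonempty := by
  refine hS.1.2 a b fun p hp q hq => B.mackey ?_ ?_
  · exact B.bicommutant_subset (by rintro x rfl; exact ha) hp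
  · exact B.bicommutant_subset (by rintro x rfl; exact hb) hq

theorem cover_mem (hS : 𝒥.IsSpectral) (ha : a ∈ B.cblock) : 𝒥.cover a ∈ B.carrier :=
  B.mem_of_mem_cblock (hS.2.cover_mem a) fun s hs =>
    hS.2.cover_mem_commutant (B.proj hs) (ha s hs)

theorem meet_eq (hp : p ∈ B.carrier) (ha : a ∈ B.cblock) : meet a p = 𝒥.J p a :=
  EffectAlgebra.meet_eq (𝒥.isGLB_J (B.proj hp) (ha p hp))

end Block

/-! ### Existence of a C-block containing a given element. -/

section exists_block

variable {E : Type*} [EffectAlgebra E] {𝒥 : CompressionBase E}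

/-- The Boolean splitting $x=(x\wedge y^c)\vee(x\wedge y)$ is an orthogonal sum in $E$: the sum is
at most $x$ because projections are principal, and at least $x$ because it is an upper bound lying
in the subalgebra. -/
theorem IsBooleanSubalgebra.mackey {D : SubEffectAlgebra E} (hD : 𝒥.IsBooleanSubalgebra D)
    {p q : E} (hp : p ∈ D) (hq : q ∈ D) : Mackey p q := by
  obtain ⟨hP, β, _, f, hf, hc⟩ := hD
  have hmem : ∀ x, f x ∈ D := fun x => by
    change f x ∈ (D : Set E)
    rw [← hf]
    exact ⟨x, rfl⟩
  have hle : ∀ x y, x ≤ yᶜ → f x ≤ orth (f y) := fun x y h => by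
    rw [← hc]
    exact f.monotone h
  have key : ∀ x y, oplus (f (x ⊓ yᶜ)) (f (x ⊓ y)) = some (f x) := by
    intro x y
    obtain ⟨s, hs⟩ := exists_oplus_of_le_orth (hle (x ⊓ yᶜ) (x ⊓ y) (by
      rw [compl_inf]
      exact inf_le_right.trans le_sup_right))
    have hsD : s ∈ (D : Set E) := D.oplus_mem _ (hmem _) _ (hmem _) _ hs
    rw [← hf] at hsD
    obtain ⟨t, rfl⟩ := hsD
    have h1 : f t ≤ f x := 𝒥.oplus_le (hP _ (hmem x)) (f.monotone inf_le_left)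
      (f.monotone inf_le_left) hs
    have h2 : x ≤ t := by
      have e1 := f.le_iff_le.1 (le_of_oplus hs)
      have e2 := f.le_iff_le.1 (le_of_oplus' hs)
      calc x = x ⊓ yᶜ ⊔ x ⊓ y := by rw [sup_comm, sup_inf_inf_compl]
        _ ≤ t := sup_le e1 e2
    rw [hs, le_antisymm h1 (f.monotone h2)]
  have hp' : p ∈ Set.range f := by rw [hf]; exact hp
  have hq' : q ∈ Set.range f := by rw [hf]; exact hq
  obtain ⟨x, rfl⟩ := hp'
  obtain ⟨y, rfl⟩ := hq'
  have hxy := key x y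
  have hyx := key y x
  rw [inf_comm y x] at hyx
  obtain ⟨e, he⟩ := exists_oplus_of_le_orth (hle x (y ⊓ xᶜ) (by
    rw [compl_inf, compl_compl]
    exact le_sup_right))
  have hxy' := oplus_comm' _ _ _ hxy
  have he' := oplus_comm' _ _ _ he
  obtain ⟨d, hd, hd'⟩ := oplus_assoc_left hxy he'
  exact ⟨_, _, _, d, e, oplus_comm' _ _ _ hd, hd', hxy, hyx⟩

/-- Zorn extends $B(a)$ to a block; each of its members commutes with $B(a)$, hence with $a$ by the
b-property. -/
theorem exists_block (hS : 𝒥.IsSpectral) (a : E) : ∃ B : 𝒥.Block, a ∈ B.cblock := by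
  obtain ⟨D, hD, hDa⟩ := hS.1.1 a
  obtain ⟨M, hM, hMmax⟩ := zorn_subset_nonempty
    {S : Set E | S ⊆ (𝒥.P : Set E) ∧ ∀ p ∈ S, ∀ q ∈ S, Mackey p q} (by
      intro c hc hchain _
      refine ⟨⋃₀ c, ⟨Set.sUnion_subset fun s hs => (hc hs).1, ?_⟩,
        fun s hs => Set.subset_sUnion_of_mem hs⟩
      rintro p ⟨s, hs, hp⟩ q ⟨t, ht, hq⟩
      rcases hchain.total hs ht with h | h
      · exact (hc ht).2 p (h hp) q hq
      · exact (hc hs).2 p hp q (h hq)) (D : Set E)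
      ⟨fun p hp => hD.1 p hp, fun p hp q hq => hD.mackey hp hq⟩
  refine ⟨⟨M, hMmax⟩, fun p hp => ?_⟩
  have hpP : p ∈ 𝒥.P := hMmax.prop.1 hp
  exact (hDa p hpP).2 fun q hq =>
    𝒥.mem_commutant_of_mackey hpP (hMmax.prop.2 q (hM hq) p hp)

end exists_block

end CompressionBase

/-! ### The linearly ordered group of a totally ordered effect algebra -/

/-- Nontrivial totally ordered effect algebras. -/
class EffectChain (T : Type*) extends EffectAlgebra T where
  total : ∀ a b : T, (∃ c, oplus a c = some b) ∨ ∃ c, oplus b c = some a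
  zero_ne_one : (0 : T) ≠ 1

namespace EffectChain

variable {T : Type*} [EffectChain T]

/-- `Carry s t ε r` expresses that `s + t = ε + r` with `ε ∈ {0, 1}` and `r < 1`. -/
def Carry (s t : T) (ε : ℤ) (r : T) : Prop :=
  r ≠ 1 ∧ (ε = 0 ∧ oplus s t = some r ∨ ε = 1 ∧ oplus (orth t) r = some s)

theorem ne_one_of_le {s t : T} (h : s ≤ t) (ht : t ≠ 1) : s ≠ 1 := by
  rintro rfl
  exact ht (le_antisymm (le_one' t) h)

theorem oplus_orth_symm {s t r : T} (h : oplus (orth t) r = some s) :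
    oplus (orth s) r = some t := by
  have := orth_oplus_of_oplus (oplus_comm' _ _ _ h)
  rwa [orth_orth] at this

theorem Carry.symm {s t r : T} {ε : ℤ} (h : Carry s t ε r) : Carry t s ε r := by
  obtain ⟨hr, ⟨h1, h2⟩ | ⟨h1, h2⟩⟩ := h
  · exact ⟨hr, Or.inl ⟨h1, oplus_comm' _ _ _ h2⟩⟩
  · exact ⟨hr, Or.inr ⟨h1, oplus_orth_symm h2⟩⟩

theorem Carry.nonneg {s t r : T} {ε : ℤ} (h : Carry s t ε r) : 0 ≤ ε := by
  obtain ⟨-, ⟨rfl, -⟩ | ⟨rfl, -⟩⟩ := h <;> decide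

theorem exists_carry {s t : T} (hs : s ≠ 1) : ∃ x : ℤ × T, Carry s t x.1 x.2 := by
  rcases total (orth t) s with ⟨c, hc⟩ | hc
  · exact ⟨(1, c), ne_one_of_le (le_of_oplus' hc) hs, Or.inr ⟨rfl, hc⟩⟩
  · obtain ⟨r, hr⟩ := exists_oplus_of_le_orth (b := t) (a := s) hc
    -- A sum equal to $1$ is recorded as carry $1$ with remainder $0$, since remainders must differ
    -- from $1$.
    by_cases h1 : r = 1
    · subst h1
      refine ⟨(1, 0), zero_ne_one, Or.inr ⟨rfl, ?_⟩⟩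
      rw [oplus_zero, ← eq_orth (oplus_comm' _ _ _ hr)]
    · exact ⟨(0, r), h1, Or.inl ⟨rfl, hr⟩⟩

/-- The two alternatives of a carry overlap only at $s=t'$, where the sum would be the excluded
remainder $1$. -/
theorem not_carry_both {s t r r' : T} (h1 : oplus s t = some r) (hr : r ≠ 1)
    (h2 : oplus (orth t) r' = some s) : False := by
  have h3 : orth t ≤ s := le_of_oplus h2
  have h4 : s = orth t := le_antisymm (le_orth_of_oplus h1) h3
  subst h4
  exact hr (oplus_inj h1 (orth_oplus t))

theorem Carry.unique {s t r r' : T} {ε ε' : ℤ} (h : Carry s t ε r) (h' : Carry s t ε' r') :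
    ε = ε' ∧ r = r' := by
  obtain ⟨hr, ⟨rfl, h1⟩ | ⟨rfl, h1⟩⟩ := h <;> obtain ⟨hr', ⟨rfl, h2⟩ | ⟨rfl, h2⟩⟩ := h'
  · exact ⟨rfl, oplus_inj h1 h2⟩
  · exact (not_carry_both h1 hr h2).elim
  · exact (not_carry_both h2 hr' h1).elim
  · exact ⟨rfl, oplus_cancel h1 h2⟩

/-- Associativity of the addition with carry. -/
theorem Carry.assoc {s t u r x y z : T} {ε ε' δ δ' : ℤ} (h1 : Carry s t ε r)
    (h2 : Carry r u ε' x) (h3 : Carry t u δ y) (h4 : Carry s y δ' z) :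
    ε + ε' = δ + δ' ∧ x = z := by
  have hx := h2.1
  -- By uniqueness of carries it is enough to exhibit one carry for $s+y$. Of the eight combinations
  -- of the given carries $(\varepsilon,\varepsilon',\delta)$, $(0,0,1)$ and $(1,1,0)$ are
  -- impossible.
  suffices h : Carry s y (ε + ε' - δ) x by
    have := h.unique h4
    exact ⟨by linarith [this.1], this.2⟩
  refine ⟨hx, ?_⟩
  obtain ⟨hr, ⟨rfl, h1⟩ | ⟨rfl, h1⟩⟩ := h1 <;> obtain ⟨-, ⟨rfl, h2⟩ | ⟨rfl, h2⟩⟩ := h2 <;>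
    obtain ⟨hy, ⟨rfl, h3⟩ | ⟨rfl, h3⟩⟩ := h3
  · obtain ⟨f, hf, hf'⟩ := oplus_assoc' _ _ _ _ _ h1 h2
    exact Or.inl ⟨rfl, oplus_inj h3 hf ▸ hf'⟩
  · obtain ⟨f, hf, hf'⟩ := oplus_assoc' _ _ _ _ _ h1 h2
    exact (not_carry_both hf (ne_one_of_le (le_of_oplus' hf') hx) h3).elim
  · -- `s ⊕ t = u' ⊕ x` and `t ⊕ u = y`
    have e1 := orth_oplus_of_oplus h3
    obtain ⟨f, hf, hf'⟩ := oplus_assoc' _ _ _ _ _ e1 h2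
    obtain ⟨g, hg, hg'⟩ := oplus_assoc_left (oplus_comm' _ _ _ hf) hf'
    exact Or.inr ⟨rfl, oplus_cancel_right hg' h1 ▸ hg⟩
  · -- `s ⊕ t = u' ⊕ x` and `t = u' ⊕ y`
    obtain ⟨g, hg, hg'⟩ := oplus_assoc_left (oplus_comm' _ _ _ h3) h1
    exact Or.inl ⟨rfl, oplus_cancel_right hg' (oplus_comm' _ _ _ h2) ▸ hg⟩
  · -- `s = t' ⊕ r`, `r ⊕ u = x` and `t ⊕ u = y`
    have e1 := orth_oplus_of_oplus (oplus_comm' _ _ _ h3)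
    obtain ⟨f, hf, hf'⟩ := oplus_assoc' _ _ _ _ _ e1 h1
    exact Or.inr ⟨rfl, oplus_inj (oplus_comm' _ _ _ h2) hf ▸ hf'⟩
  · -- `s = t' ⊕ r`, `r ⊕ u = x` and `t = u' ⊕ y`
    have e1 := orth_oplus_of_oplus (oplus_comm' _ _ _ h3)
    rw [orth_orth] at e1
    obtain ⟨f, hf, hf'⟩ := oplus_assoc_left e1 h2
    exact Or.inl ⟨rfl, oplus_inj (oplus_comm' _ _ _ hf) h1 ▸ hf'⟩
  · -- `s = t' ⊕ r`, `r = u' ⊕ x` and `t ⊕ u = y`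
    have e1 : orth u ≤ t :=
      (le_of_oplus h2).trans (by simpa [orth_orth] using le_orth_of_oplus (oplus_comm' _ _ _ h1))
    obtain ⟨v, hv⟩ := e1
    exact (not_carry_both h3 hy hv).elim
  · -- `s = t' ⊕ r`, `r = u' ⊕ x` and `t = u' ⊕ y`
    have e1 := orth_oplus_of_oplus h3
    obtain ⟨f, hf, hf'⟩ := oplus_assoc_left h2 h1
    exact Or.inr ⟨rfl, oplus_inj hf e1 ▸ hf'⟩

end EffectChain

/-- The group of all `n + t`, where `n` is an integer and `t < 1` belongs to the chain `T`. -/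
@[ext]
structure ChainGroup (T : Type*) [EffectChain T] where
  int : ℤ
  frac : T
  ne : frac ≠ 1

namespace ChainGroup

open EffectChain

variable {T : Type*} [EffectChain T]

noncomputable instance : Add (ChainGroup T) where
  add x y := ⟨x.int + y.int + (exists_carry (t := y.frac) x.ne).choose.1,
    (exists_carry (t := y.frac) x.ne).choose.2, (exists_carry (t := y.frac) x.ne).choose_spec.1⟩

instance : Zero (ChainGroup T) where
  zero := ⟨0, 0, zero_ne_one⟩

theorem exists_add (x y : ChainGroup T) :
    ∃ ε : ℤ, Carry x.frac y.frac ε (x + y).frac ∧ (x + y).int = x.int + y.int + ε :=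
  ⟨_, (exists_carry (t := y.frac) x.ne).choose_spec, rfl⟩

theorem add_eq {x y z : ChainGroup T} {ε : ℤ} (h : Carry x.frac y.frac ε z.frac)
    (h' : z.int = x.int + y.int + ε) : x + y = z := by
  obtain ⟨δ, h1, h2⟩ := exists_add x y
  obtain ⟨h3, h4⟩ := h1.unique h
  ext
  · rw [h2, h', h3]
  · exact h4

theorem zero_add' (x : ChainGroup T) : 0 + x = x :=
  add_eq (ε := 0) ⟨x.ne, Or.inl ⟨rfl, zero_oplus _⟩⟩ (by change x.int = 0 + x.int + 0; ring)

theorem add_comm' (x y : ChainGroup T) : x + y = y + x := by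
  obtain ⟨δ, h1, h2⟩ := exists_add y x
  exact add_eq h1.symm (by rw [h2]; ring)

theorem add_assoc' (x y z : ChainGroup T) : x + y + z = x + (y + z) := by
  obtain ⟨ε, h1, h1'⟩ := exists_add x y
  obtain ⟨ε', h2, h2'⟩ := exists_add (x + y) z
  obtain ⟨δ, h3, h3'⟩ := exists_add y z
  obtain ⟨δ', h4, h4'⟩ := exists_add x (y + z)
  obtain ⟨h5, h6⟩ := h1.assoc h2 h3 h4
  ext
  · rw [h2', h4', h1', h3']
    linarith
  · exact h6

theorem exists_neg (x : ChainGroup T) : ∃ y : ChainGroup T, y + x = 0 := by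
  by_cases h : x.frac = 0
  · refine ⟨⟨-x.int, 0, zero_ne_one⟩, add_eq (ε := 0) ⟨zero_ne_one, Or.inl ⟨rfl, ?_⟩⟩ ?_⟩
    · rw [h]
      exact oplus_zero 0
    · change 0 = -x.int + x.int + 0
      ring
  · refine ⟨⟨-x.int - 1, orth x.frac, fun h1 => h ?_⟩,
      add_eq (ε := 1) ⟨zero_ne_one, Or.inr ⟨rfl, oplus_zero _⟩⟩ ?_⟩
    · rw [← orth_orth x.frac, h1, orth_one]
    · change 0 = -x.int - 1 + x.int + 1
      ring

noncomputable instance : Neg (ChainGroup T) where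
  neg x := (exists_neg x).choose

noncomputable instance : AddCommGroup (ChainGroup T) :=
  { AddGroup.ofLeftAxioms add_assoc' zero_add' (fun x => (exists_neg x).choose_spec) with
    add_comm := add_comm' }

theorem int_zero : (0 : ChainGroup T).int = 0 := rfl

theorem frac_zero : (0 : ChainGroup T).frac = 0 := rfl

theorem neg_cases (x : ChainGroup T) :
    (-x).int = -x.int ∧ x.frac = 0 ∨ (-x).int = -x.int - 1 := by
  obtain ⟨ε, h, h'⟩ := exists_add x (-x)
  rw [add_neg_cancel, int_zero] at h'
  rw [add_neg_cancel, frac_zero] at h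
  obtain ⟨-, ⟨rfl, h1⟩ | ⟨rfl, -⟩⟩ := h
  · exact Or.inl ⟨by linarith, eq_zero_of_oplus_eq_zero (oplus_comm' _ _ _ h1)⟩
  · exact Or.inr (by linarith)

/-- The cone of nonnegative elements. -/
noncomputable def cone (T : Type*) [EffectChain T] : AddGroupCone (ChainGroup T) where
  -- The fractional part is never negative, so the integer part alone decides the sign.
  carrier := {x | 0 ≤ x.int}
  add_mem' := by
    intro x y hx hy
    obtain ⟨ε, h, h'⟩ := exists_add x y
    have := h.nonneg
    simp only [Set.mem_ofPred_eq] at *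
    omega
  zero_mem' := le_refl (0 : ℤ)
  eq_zero_of_mem_of_neg_mem' := by
    intro x hx hy
    have h1 : 0 ≤ x.int := hx
    have h2 : 0 ≤ (-x).int := hy
    rcases neg_cases x with ⟨h3, h4⟩ | h3
    · ext
      · rw [int_zero]
        omega
      · exact h4
    · omega

instance : HasMemOrNegMem (cone T) where
  mem_or_neg_mem x := by
    change 0 ≤ x.int ∨ 0 ≤ (-x).int
    rcases neg_cases x with ⟨h3, -⟩ | h3 <;> omega

open Classical in
noncomputable instance : LinearOrder (ChainGroup T) := LinearOrder.mkOfAddGroupCone (cone T)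

instance : IsOrderedAddMonoid (ChainGroup T) := IsOrderedAddMonoid.mkOfCone (cone T)

theorem nonneg_iff {x : ChainGroup T} : 0 ≤ x ↔ 0 ≤ x.int := by
  have : 0 ≤ x ↔ x - 0 ∈ cone T := Iff.rfl
  rw [this, sub_zero]
  rfl

/-- The embedding of the chain `T` into its group. -/
noncomputable def ofChain (t : T) : ChainGroup T := by
  classical exact if h : t = 1 then ⟨1, 0, zero_ne_one⟩ else ⟨0, t, h⟩

theorem ofChain_nonneg (t : T) : 0 ≤ ofChain t := by
  rw [nonneg_iff]
  unfold ofChain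
  split_ifs <;> simp

theorem ofChain_eq_zero {t : T} (h : ofChain t = 0) : t = 0 := by
  unfold ofChain at h
  split_ifs at h with h1
  · have := congrArg int h
    simp [int_zero] at this
  · exact congrArg frac h

theorem ofChain_zero : ofChain (0 : T) = 0 := by
  unfold ofChain
  rw [dif_neg EffectChain.zero_ne_one]
  rfl

theorem ofChain_add {s t r : T} (h : oplus s t = some r) :
    ofChain s + ofChain t = ofChain r := by
  by_cases hs : s = 1
  · subst hs
    obtain rfl : t = 0 := eq_zero_of_oplus_one _ _ (oplus_comm' _ _ _ h)
    rw [oplus_zero] at h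
    rw [ofChain_zero, add_zero, Option.some.inj h]
  by_cases ht : t = 1
  · subst ht
    obtain rfl : s = 0 := eq_zero_of_oplus_one _ _ h
    rw [zero_oplus] at h
    rw [ofChain_zero, zero_add, Option.some.inj h]
  by_cases hr : r = 1
  · subst hr
    refine add_eq (ε := 1) ?_ ?_
    · simp only [ofChain, dif_neg hs, dif_neg ht, dif_pos]
      exact ⟨zero_ne_one, Or.inr ⟨rfl, by rw [oplus_zero, ← eq_orth (oplus_comm' _ _ _ h)]⟩⟩
    · simp [ofChain, dif_neg hs, dif_neg ht]
  · refine add_eq (ε := 0) ?_ ?_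
    · simp only [ofChain, dif_neg hs, dif_neg ht, dif_neg hr]
      exact ⟨hr, Or.inl ⟨rfl, h⟩⟩
    · simp [ofChain, dif_neg hs, dif_neg ht, dif_neg hr]

end ChainGroup

/-! ### Homomorphisms out of the universal group. -/

namespace UnivGroup

variable {F G : Type*} [EffectAlgebra F] [AddCommGroup G]

/-- The universal property of the universal group. -/
def lift (f : F → G) (hf : ∀ a b c, oplus a b = some c → f a + f b = f c) : UnivGroup F →+ G :=
  QuotientAddGroup.lift _ (FreeAbelianGroup.lift f) <| by
    rw [AddSubgroup.closure_le]
    rintro _ ⟨a, b, c, h, rfl⟩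
    simp [← hf a b c h]

theorem lift_of (f : F → G) (hf : ∀ a b c, oplus a b = some c → f a + f b = f c) (a : F) :
    lift f hf (of a) = f a := by
  simp [lift, of]

theorem hom_ext {φ ψ : UnivGroup F →+ G} (h : ∀ a, φ (of a) = ψ (of a)) : φ = ψ := by
  apply QuotientAddGroup.addMonoidHom_ext
  ext a
  exact h a

theorem of_zero : of (0 : F) = 0 := by
  have := of_add (oplus_zero (0 : F))
  simpa using this

end UnivGroup

namespace CompressionBase

/-- The points of the Stone space of a block: its ultrafilters. -/
structure Point {E : Type*} [EffectAlgebra E] {𝒥 : CompressionBase E} (hS : 𝒥.IsSpectral)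
    (B : 𝒥.Block) where
  carrier : Set E
  subset : carrier ⊆ B.carrier
  zero_notMem : (0 : E) ∉ carrier
  J_mem : ∀ p ∈ carrier, ∀ q ∈ carrier, 𝒥.J p q ∈ carrier
  mem_of_le : ∀ p ∈ carrier, ∀ q ∈ B.carrier, p ≤ q → q ∈ carrier
  mem_or_orth_mem : ∀ p ∈ B.carrier, p ∈ carrier ∨ orth p ∈ carrier

namespace Point

/-! ### Ultrafilters of a block. -/

section ultrafilter

variable {E : Type*} [EffectAlgebra E] {𝒥 : CompressionBase E} {hS : 𝒥.IsSpectral}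
  {B : 𝒥.Block}

instance : Membership E (Point hS B) := ⟨fun χ p => p ∈ χ.carrier⟩

variable (χ : Point hS B) {p q : E}

theorem mem_block (hp : p ∈ χ) : p ∈ B.carrier := χ.subset hp

theorem orth_notMem (hp : p ∈ χ) : orth p ∉ χ := fun h => χ.zero_notMem <| by
  have := χ.J_mem p hp _ h
  rwa [𝒥.J_of_le_orth (B.proj (χ.subset hp)) le_rfl] at this

theorem orth_mem_iff (hp : p ∈ B.carrier) : orth p ∈ χ ↔ p ∉ χ :=
  ⟨fun h h' => χ.orth_notMem h' h, fun h => (χ.mem_or_orth_mem p hp).resolve_left h⟩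

theorem one_mem : (1 : E) ∈ χ := by
  rcases χ.mem_or_orth_mem 1 B.one_mem with h | h
  · exact h
  · rw [orth_one] at h
    exact (χ.zero_notMem h).elim

theorem J_mem_iff (hp : p ∈ B.carrier) (hq : q ∈ B.carrier) :
    𝒥.J p q ∈ χ ↔ p ∈ χ ∧ q ∈ χ := by
  refine ⟨fun h => ⟨χ.mem_of_le _ h _ hp (𝒥.J_le (B.proj hp) q), ?_⟩,
    fun h => χ.J_mem p h.1 q h.2⟩
  refine χ.mem_of_le _ h _ hq ?_
  rw [𝒥.J_comm_proj (B.proj hp) (B.proj hq) (B.mackey hp hq)]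
  exact 𝒥.J_le (B.proj hq) p

variable (hS)

/-- The ultrafilter lemma, with $J_p(q)$ as the meet: Zorn is applied to families closed under meets
and avoiding $0$. -/
theorem exists_mem (hp : p ∈ B.carrier) (h0 : p ≠ 0) : ∃ χ : Point hS B, p ∈ χ := by
  obtain ⟨M, hM, hMmax⟩ := zorn_subset_nonempty
    {S : Set E | S ⊆ B.carrier ∧ (0 : E) ∉ S ∧ (∀ p ∈ S, ∀ q ∈ S, 𝒥.J p q ∈ S)} (by
      intro c hc hchain _
      refine ⟨⋃₀ c, ⟨Set.sUnion_subset fun s hs => (hc hs).1, ?_, ?_⟩,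
        fun s hs => Set.subset_sUnion_of_mem hs⟩
      · rintro ⟨s, hs, h⟩
        exact (hc hs).2.1 h
      · rintro p ⟨s, hs, hp⟩ q ⟨t, ht, hq⟩
        rcases hchain.total hs ht with h | h
        · exact ⟨t, ht, (hc ht).2.2 p (h hp) q hq⟩
        · exact ⟨s, hs, (hc hs).2.2 p hp q (h hq)⟩) {p}
      ⟨by rintro x rfl; exact hp, fun h => h0 (h : 0 = p).symm, by
        rintro x rfl y rfl
        exact 𝒥.J_of_le (B.proj hp) le_rfl⟩
  obtain ⟨hMB, hM0, hMJ⟩ := hMmax.prop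
  have hpM : p ∈ M := hM rfl
  -- adjoining a projection that meets all members of `M`
  have key : ∀ q ∈ B.carrier, (∀ s ∈ M, 𝒥.J s q ≠ 0) → q ∈ M := by
    intro q hq h
    have hJ : ∀ s ∈ M, 𝒥.J s q ∈ B.carrier := fun s hs => B.J_mem_carrier (hMB hs) hq
    have hle : M ⊆ M ∪ {x | ∃ s ∈ M, x = 𝒥.J s q} ∪ {q} := fun x hx => Or.inl (Or.inl hx)
    refine hMmax.le_of_ge (y := M ∪ {x | ∃ s ∈ M, x = 𝒥.J s q} ∪ {q}) ⟨?_, ?_, ?_⟩ hle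
      (Or.inr rfl)
    · rintro x ((hx | ⟨s, hs, rfl⟩) | rfl)
      · exact hMB hx
      · exact hJ s hs
      · exact hq
    · rintro ((hx | ⟨s, hs, hx⟩) | hx)
      · exact hM0 hx
      · exact h s hs hx.symm
      · obtain rfl : 0 = q := hx
        exact h p hpM (𝒥.J_zero (B.proj hp))
    · have hqP := B.proj hq
      have hqq : 𝒥.J q q = q := 𝒥.J_of_le hqP le_rfl
      have hcomm : ∀ s ∈ M, 𝒥.J q s = 𝒥.J s q := fun s hs =>
        𝒥.J_comm_proj hqP (B.proj (hMB hs)) (B.mackey hq (hMB hs))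
      rintro x ((hx | ⟨s, hs, rfl⟩) | rfl) y ((hy | ⟨t, ht, rfl⟩) | rfl)
      · exact Or.inl (Or.inl (hMJ x hx y hy))
      · exact Or.inl (Or.inr ⟨_, hMJ x hx t ht, (B.J_J_eq (hMB hx) (hMB ht) q).symm⟩)
      · exact Or.inl (Or.inr ⟨x, hx, rfl⟩)
      · refine Or.inl (Or.inr ⟨_, hMJ s hs y hy, ?_⟩)
        rw [B.J_J_eq (hMB hs) hq, B.J_J_eq (hMB hs) (hMB hy), hcomm y hy]
      · refine Or.inl (Or.inr ⟨_, hMJ s hs t ht, ?_⟩)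
        rw [B.J_J_eq (hMB hs) hq, B.J_J_eq (hMB hs) (hMB ht), B.J_comm hq (hMB ht), hqq]
      · refine Or.inl (Or.inr ⟨s, hs, ?_⟩)
        rw [B.J_J_eq (hMB hs) hq, hqq]
      · exact Or.inl (Or.inr ⟨y, hy, hcomm y hy⟩)
      · refine Or.inl (Or.inr ⟨t, ht, ?_⟩)
        rw [B.J_comm hq (hMB ht), hqq]
      · exact Or.inr hqq
  refine ⟨⟨M, hMB, hM0, hMJ, fun s hs q hq hsq => key q hq fun t ht h => ?_, fun q hq => ?_⟩, hpM⟩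
  · have h1 := hMJ t ht s hs
    have h2 : 𝒥.J t s = 0 := eq_zero_of_le_zero (h ▸ 𝒥.J_mono (B.proj (hMB ht)) hsq)
    exact hM0 (h2 ▸ h1)
  -- If neither $q$ nor $q'$ is in $M$, some $s,t\in M$ satisfy $s\wedge q=0$ and $t\wedge q'=0$.
  -- Then $t\le q\le s'$, so $0=J_s(t)\in M$.
  · by_contra hcon
    obtain ⟨h1, h2⟩ := not_or.1 hcon
    have e1 := fun h => h1 (key q hq h)
    have e2 := fun h => h2 (key (orth q) (B.orth_mem hq) h)
    simp only [imp_false, not_forall, not_not] at e1 e2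
    obtain ⟨s, hs, hs'⟩ := e1
    obtain ⟨t, ht, ht'⟩ := e2
    have hsP := B.proj (hMB hs)
    have htP := B.proj (hMB ht)
    have h3 : q ≤ orth s := (𝒥.J_eq_zero_iff hsP).1 hs'
    have h4 : t ≤ q := by
      have := le_orth_comm ((𝒥.J_eq_zero_iff htP).1 ht')
      rwa [orth_orth] at this
    have h5 := hMJ s hs t ht
    rw [𝒥.J_of_le_orth hsP (h4.trans h3)] at h5
    exact hM0 h5

end ultrafilter

/-! ### The totally ordered effect algebra of germs at a point. -/

section germ

variable {E : Type*} [EffectAlgebra E] {𝒥 : CompressionBase E} {hS : 𝒥.IsSpectral}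
  {B : 𝒥.Block} (χ : Point hS B)

/-- Take $r=J_p(q)$: since $J_r=J_pJ_q=J_qJ_p$, agreement under either factor passes to $r$. -/
theorem exists_common (p q : B.carrier) (hp : (p : E) ∈ χ) (hq : (q : E) ∈ χ) :
    ∃ r : B.carrier, (r : E) ∈ χ ∧
      (∀ a b, B.restrict p a = B.restrict p b → B.restrict r a = B.restrict r b) ∧
      ∀ a b, B.restrict q a = B.restrict q b → B.restrict r a = B.restrict r b := by
  refine ⟨⟨𝒥.J p q, B.J_mem_carrier p.2 q.2⟩, χ.J_mem _ hp _ hq, fun a b h => ?_, fun a b h => ?_⟩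
  · have h' : 𝒥.J p a = 𝒥.J p b := congrArg Subtype.val h
    apply Subtype.ext
    change 𝒥.J (𝒥.J p q) a = 𝒥.J (𝒥.J p q) b
    rw [B.J_J_eq p.2 q.2, B.J_J_eq p.2 q.2, B.J_comm p.2 q.2, B.J_comm p.2 q.2, h']
  · have h' : 𝒥.J q a = 𝒥.J q b := congrArg Subtype.val h
    apply Subtype.ext
    change 𝒥.J (𝒥.J p q) a = 𝒥.J (𝒥.J p q) b
    rw [B.J_J_eq p.2 q.2, B.J_J_eq p.2 q.2, h']

/-- Two elements of the C-block have the same germ at `χ` if they agree under some `J_p` with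
`p ∈ χ`. -/
def setoid : Setoid B.cblock where
  r a b := ∃ p : B.carrier, (p : E) ∈ χ ∧ B.restrict p a = B.restrict p b
  iseqv :=
    { refl := fun _ => ⟨⟨1, B.one_mem⟩, χ.one_mem, rfl⟩
      symm := fun ⟨p, hp, h⟩ => ⟨p, hp, h.symm⟩
      trans := fun ⟨p, hp, h⟩ ⟨q, hq, h'⟩ => by
        obtain ⟨r, hr, h1, h2⟩ := χ.exists_common p q hp hq
        exact ⟨r, hr, (h1 _ _ h).trans (h2 _ _ h')⟩ }

/-- The germs at `χ` of the elements of the C-block. -/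
def Germ : Type _ := Quotient χ.setoid

/-- The germ of an element. -/
def germ (a : B.cblock) : χ.Germ := Quotient.mk χ.setoid a

variable {χ}

theorem germ_eq_iff {a b : B.cblock} : χ.germ a = χ.germ b ↔
    ∃ p : B.carrier, (p : E) ∈ χ ∧ B.restrict p a = B.restrict p b :=
  Quotient.eq (r := χ.setoid)

theorem germ_surj (x : χ.Germ) : ∃ a, χ.germ a = x := Quotient.exists_rep x

theorem restrict_restrict (p : B.carrier) (a : B.cblock) :
    B.restrict p (B.restrict p a) = B.restrict p a :=
  Subtype.ext (𝒥.J_J (B.proj p.2) a)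

theorem germ_restrict {p : B.carrier} (hp : (p : E) ∈ χ) (a : B.cblock) :
    χ.germ (B.restrict p a) = χ.germ a :=
  germ_eq_iff.2 ⟨p, hp, restrict_restrict p a⟩

/-- Under a common $J_r$ the corresponding summands coincide, hence so do the sums. This makes
addition of germs independent of the representatives. -/
theorem germ_oplus {a a₁ b b₁ c c₁ : B.cblock} (ha : χ.germ a = χ.germ a₁)
    (hb : χ.germ b = χ.germ b₁) (h : oplus a b = some c) (h₁ : oplus a₁ b₁ = some c₁) :
    χ.germ c = χ.germ c₁ := by
  obtain ⟨p, hp, hp'⟩ := germ_eq_iff.1 ha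
  obtain ⟨q, hq, hq'⟩ := germ_eq_iff.1 hb
  obtain ⟨r, hr, h1, h2⟩ := χ.exists_common p q hp hq
  refine germ_eq_iff.2 ⟨r, hr, ?_⟩
  have e1 := B.restrict_additive r _ _ _ h
  have e2 := B.restrict_additive r _ _ _ h₁
  rw [h1 _ _ hp', h2 _ _ hq'] at e1
  exact oplus_inj e1 e2

open Classical in
/-- The partial addition of germs. -/
noncomputable def add (x y : χ.Germ) : Option χ.Germ :=
  if h : ∃ c a b : B.cblock, χ.germ a = x ∧ χ.germ b = y ∧ oplus a b = some c then
    some (χ.germ h.choose) else none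

theorem add_eq_some {x y z : χ.Germ} : add x y = some z ↔
    ∃ a b c : B.cblock, χ.germ a = x ∧ χ.germ b = y ∧ χ.germ c = z ∧ oplus a b = some c := by
  unfold add
  constructor
  · intro h
    split_ifs at h with h1
    obtain ⟨a, b, ha, hb, hc⟩ := h1.choose_spec
    exact ⟨a, b, _, ha, hb, Option.some.inj h, hc⟩
  · rintro ⟨a, b, c, ha, hb, rfl, hc⟩
    have h1 : ∃ c a b : B.cblock, χ.germ a = x ∧ χ.germ b = y ∧ oplus a b = some c :=
      ⟨c, a, b, ha, hb, hc⟩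
    rw [dif_pos h1]
    obtain ⟨a', b', ha', hb', hc'⟩ := h1.choose_spec
    rw [germ_oplus (ha'.trans ha.symm) (hb'.trans hb.symm) hc' hc]

noncomputable instance : EffectAlgebra χ.Germ where
  zero := χ.germ 0
  one := χ.germ 1
  oplus := add
  oplus_comm' x y z h := by
    obtain ⟨a, b, c, ha, hb, hc, h⟩ := add_eq_some.1 h
    exact add_eq_some.2 ⟨b, a, c, hb, ha, hc, oplus_comm' _ _ _ h⟩
  oplus_assoc' x y z w v h1 h2 := by
    obtain ⟨a, b, d, rfl, rfl, rfl, h3⟩ := add_eq_some.1 h1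
    obtain ⟨d₁, c, e, hd, rfl, rfl, h4⟩ := add_eq_some.1 h2
    obtain ⟨p, hp, hp'⟩ := germ_eq_iff.1 hd
    -- The two representatives of the partial sum agree only under $J_p$, so associativity is
    -- applied after $J_p$, which leaves all germs unchanged.
    have e1 := B.restrict_additive p _ _ _ h3
    have e2 := B.restrict_additive p _ _ _ h4
    rw [hp'] at e2
    obtain ⟨f, hf, hf'⟩ := oplus_assoc' _ _ _ _ _ e1 e2
    exact ⟨χ.germ f,
      add_eq_some.2 ⟨_, _, _, germ_restrict hp _, germ_restrict hp _, rfl, hf⟩,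
      add_eq_some.2 ⟨_, _, _, germ_restrict hp _, rfl, germ_restrict hp _, hf'⟩⟩
  existsUnique_orth x := by
    obtain ⟨a, rfl⟩ := germ_surj x
    refine ⟨χ.germ (orth a), add_eq_some.2 ⟨a, _, 1, rfl, rfl, rfl, oplus_orth a⟩, ?_⟩
    intro y hy
    obtain ⟨a₁, b, c, ha, rfl, hc, h⟩ := add_eq_some.1 hy
    obtain ⟨p, hp, hp'⟩ := germ_eq_iff.1 ha
    obtain ⟨q, hq, hq'⟩ := germ_eq_iff.1 hc
    obtain ⟨r, hr, h1, h2⟩ := χ.exists_common p q hp hq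
    refine germ_eq_iff.2 ⟨r, hr, ?_⟩
    have e1 := B.restrict_additive r _ _ _ h
    have e2 := B.restrict_additive r _ _ _ (oplus_orth a)
    rw [h1 _ _ hp', h2 _ _ hq'] at e1
    exact oplus_cancel e1 e2
  eq_zero_of_oplus_one x y h := by
    obtain ⟨a, b, c, rfl, hb, rfl, h1⟩ := add_eq_some.1 h
    obtain ⟨p, hp, hp'⟩ := germ_eq_iff.1 hb
    have e1 := B.restrict_additive p _ _ _ h1
    have e2 := B.restrict_additive p _ _ _ (oplus_orth c)
    rw [hp'] at e1
    -- Here $J_p(a)\oplus p=J_p(c)\le p$.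
    have e3 := eq_zero_of_oplus_of_oplus e1 e2
    refine germ_eq_iff.2 ⟨p, hp, ?_⟩
    rw [e3, (B.restrict_additive p).map_zero]

theorem germ_add {a b c : B.cblock} (h : oplus a b = some c) :
    oplus (χ.germ a) (χ.germ b) = some (χ.germ c) :=
  add_eq_some.2 ⟨a, b, c, rfl, rfl, rfl, h⟩

theorem germ_eq_zero {a : B.cblock} (h : χ.germ a = 0) :
    ∃ p ∈ χ, 𝒥.J p a = 0 := by
  obtain ⟨p, hp, h1⟩ := germ_eq_iff.1 (h : χ.germ a = χ.germ 0)
  rw [(B.restrict_additive p).map_zero] at h1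
  exact ⟨p, hp, congrArg Subtype.val h1⟩

/-- For $p\in P_\le(a,b)$ the ultrafilter contains $p$ or $p'$, and either one decides the order of
the germs. -/
noncomputable instance : EffectChain χ.Germ where
  total x y := by
    obtain ⟨a, rfl⟩ := germ_surj x
    obtain ⟨b, rfl⟩ := germ_surj y
    have key : ∀ (a b : B.cblock) (p : B.carrier), (p : E) ∈ χ → 𝒥.J p a ≤ 𝒥.J p b →
        ∃ z, oplus (χ.germ a) z = some (χ.germ b) := by
      rintro a b p hp ⟨c, hc⟩
      have hcC := B.cblock.mem_of_oplus (B.J_mem p.2 a.2) (B.J_mem p.2 b.2) hc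
      have : oplus (B.restrict p a) ⟨c, hcC⟩ = some (B.restrict p b) :=
        (SubEffectAlgebra.oplus_eq_some _ _ _ _).2 hc
      have := germ_add (χ := χ) this
      rw [germ_restrict hp, germ_restrict hp] at this
      exact ⟨_, this⟩
    obtain ⟨p, hp, h1, h2⟩ := B.exists_comparison hS a.2 b.2
    have hpB := B.Ple_subset a.2 b.2 ⟨hp, h1, h2⟩
    rcases χ.mem_or_orth_mem p hpB with h | h
    · exact Or.inl (key a b ⟨p, hpB⟩ h h1)
    · exact Or.inr (key b a ⟨_, B.orth_mem hpB⟩ h h2)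
  zero_ne_one h := by
    obtain ⟨p, hp, h1⟩ := germ_eq_iff.1 (h : χ.germ 0 = χ.germ 1)
    rw [(B.restrict_additive p).map_zero] at h1
    have h2 : (0 : E) = 𝒥.J p 1 := congrArg Subtype.val h1
    rw [𝒥.focus _ (B.proj p.2)] at h2
    rw [← h2] at hp
    exact χ.zero_notMem hp

end germ

/-! ### Elements of the C-block and of its universal group as functions on points. -/

section values

variable {E : Type*} [EffectAlgebra E] {𝒥 : CompressionBase E} {hS : 𝒥.IsSpectral}
  {B : 𝒥.Block} (χ : Point hS B) {a b c p q : E}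

/-- The value of an element of the C-block at a point, in a linearly ordered group. -/
noncomputable def cval (a : B.cblock) : ChainGroup χ.Germ := ChainGroup.ofChain (χ.germ a)

theorem cval_add (a b c : B.cblock) (h : oplus a b = some c) :
    χ.cval a + χ.cval b = χ.cval c := ChainGroup.ofChain_add (germ_add h)

/-- The evaluation at a point of the elements of the universal group of the C-block. -/
noncomputable def ev : UnivGroup B.cblock →+ ChainGroup χ.Germ := UnivGroup.lift χ.cval χ.cval_add

theorem ev_of (a : B.cblock) : χ.ev (UnivGroup.of a) = χ.cval a := UnivGroup.lift_of _ _ _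

open Classical in
/-- The value at a point, set to `0` outside the C-block. -/
noncomputable def val (a : E) : ChainGroup χ.Germ :=
  if h : a ∈ B.cblock then χ.cval ⟨a, h⟩ else 0

theorem val_eq (a : B.cblock) : χ.val a = χ.cval a := dif_pos a.2

theorem val_add (ha : a ∈ B.cblock) (hb : b ∈ B.cblock) (h : oplus a b = some c) :
    χ.val a + χ.val b = χ.val c := by
  have hc := B.cblock.oplus_mem a ha b hb c h
  have h' : oplus (⟨a, ha⟩ : B.cblock) ⟨b, hb⟩ = some ⟨c, hc⟩ :=
    (SubEffectAlgebra.oplus_eq_some _ _ _ _).2 h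
  have := χ.cval_add _ _ _ h'
  rwa [← χ.val_eq, ← χ.val_eq, ← χ.val_eq] at this

theorem val_nonneg (a : E) : 0 ≤ χ.val a := by
  unfold val
  split_ifs
  · exact ChainGroup.ofChain_nonneg _
  · exact le_rfl

theorem exists_of_val_eq_zero (ha : a ∈ B.cblock) (h : χ.val a = 0) : ∃ p ∈ χ, 𝒥.J p a = 0 := by
  rw [χ.val_eq ⟨a, ha⟩] at h
  exact germ_eq_zero (ChainGroup.ofChain_eq_zero h)

theorem val_mono (ha : a ∈ B.cblock) (hb : b ∈ B.cblock) (h : a ≤ b) : χ.val a ≤ χ.val b := by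
  obtain ⟨c, hc⟩ := h
  rw [← χ.val_add ha (B.cblock.mem_of_oplus ha hb hc) hc]
  exact le_add_of_nonneg_right (χ.val_nonneg c)

theorem val_le_one (ha : a ∈ B.cblock) : χ.val a ≤ χ.val 1 :=
  χ.val_mono ha B.cblock.one_mem (le_one' a)

theorem val_orth (ha : a ∈ B.cblock) : χ.val (orth a) = χ.val 1 - χ.val a := by
  rw [← χ.val_add ha (B.cblock.orth_mem _ ha) (oplus_orth a), add_sub_cancel_left]

theorem val_J_of_mem (hp : p ∈ χ) (ha : a ∈ B.cblock) : χ.val (𝒥.J p a) = χ.val a := by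
  rw [χ.val_eq ⟨a, ha⟩, χ.val_eq ⟨_, B.J_mem (χ.mem_block hp) ha⟩]
  exact congrArg ChainGroup.ofChain (germ_restrict (p := ⟨p, χ.mem_block hp⟩) hp ⟨a, ha⟩)

theorem val_zero : χ.val 0 = 0 := by
  have := χ.val_add B.cblock.zero_mem B.cblock.zero_mem (oplus_zero 0)
  simpa using this

theorem val_J_of_notMem (hpB : p ∈ B.carrier) (hp : p ∉ χ) (ha : a ∈ B.cblock) :
    χ.val (𝒥.J p a) = 0 := by
  have hp' := (χ.orth_mem_iff hpB).2 hp
  rw [← χ.val_J_of_mem hp' (B.J_mem hpB ha), 𝒥.J_J_orth (B.proj hpB), val_zero]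

open Classical in
theorem val_J (hpB : p ∈ B.carrier) (ha : a ∈ B.cblock) :
    χ.val (𝒥.J p a) = if p ∈ χ then χ.val a else 0 := by
  split_ifs with h
  · exact χ.val_J_of_mem h ha
  · exact χ.val_J_of_notMem hpB h ha

open Classical in
theorem val_proj (hpB : p ∈ B.carrier) : χ.val p = if p ∈ χ then χ.val 1 else 0 := by
  rw [← χ.val_J hpB B.cblock.one_mem, 𝒥.focus p (B.proj hpB)]

theorem val_one_pos : 0 < χ.val 1 := by
  refine (χ.val_nonneg 1).lt_of_ne fun h => ?_
  obtain ⟨p, hp, h1⟩ := χ.exists_of_val_eq_zero B.cblock.one_mem h.symm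
  rw [𝒥.focus p (B.proj (χ.mem_block hp))] at h1
  exact χ.zero_notMem (h1 ▸ hp)

theorem mem_iff_val_pos (hpB : p ∈ B.carrier) : p ∈ χ ↔ 0 < χ.val p := by
  classical
  rw [χ.val_proj hpB]
  split_ifs with h <;> simp [h, χ.val_one_pos]

/-- If $a$ vanishes at $\chi$, then $J_p(a)=0$ for some $p\in\chi$, so $a^\circ\le p'$ and
$a^\circ\notin\chi$. Conversely $a=J_{a^\circ}(a)$ vanishes off $a^\circ$. -/
theorem mem_cover_iff (ha : a ∈ B.cblock) : 𝒥.cover a ∈ χ ↔ 0 < χ.val a := by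
  have hc := B.cover_mem hS ha
  constructor
  · refine fun h => (χ.val_nonneg a).lt_of_ne fun h0 => ?_
    obtain ⟨p, hp, h1⟩ := χ.exists_of_val_eq_zero ha h0.symm
    have hpB := χ.mem_block hp
    have h2 := (𝒥.J_eq_zero_iff (B.proj hpB)).1 h1
    have h3 := (hS.2.le_iff (B.proj (B.orth_mem hpB))).1 h2
    exact χ.orth_notMem hp (χ.mem_of_le _ h _ (B.orth_mem hpB) h3)
  · intro h
    by_contra h1
    have h2 := χ.val_J_of_notMem hc h1 ha
    rw [𝒥.J_of_le (B.proj hc) (hS.2.le_cover a)] at h2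
    exact h.ne' h2

theorem ev_compr_of_mem (p : B.carrier) (hp : (p : E) ∈ χ) (g : UnivGroup B.cblock) :
    χ.ev (B.compr p g) = χ.ev g := by
  have : χ.ev.comp (B.compr p) = χ.ev := UnivGroup.hom_ext fun a => by
    rw [AddMonoidHom.comp_apply, Block.compr, UnivGroup.extend_of, ev_of, ev_of, ← val_eq, ← val_eq]
    exact χ.val_J_of_mem hp a.2
  exact DFunLike.congr_fun this g

theorem ev_compr_of_notMem (p : B.carrier) (hp : (p : E) ∉ χ) (g : UnivGroup B.cblock) :
    χ.ev (B.compr p g) = 0 := by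
  have : χ.ev.comp (B.compr p) = 0 := UnivGroup.hom_ext fun a => by
    rw [AddMonoidHom.comp_apply, Block.compr, UnivGroup.extend_of, ev_of, ← val_eq]
    exact χ.val_J_of_notMem p.2 hp a.2
  exact DFunLike.congr_fun this g

theorem ev_nonneg {g : UnivGroup B.cblock} (hg : g ∈ UnivGroup.posCone B.cblock) :
    0 ≤ χ.ev g := by
  induction hg using AddSubmonoid.closure_induction with
  | mem x hx =>
    obtain ⟨a, rfl⟩ := hx
    rw [ev_of]
    exact ChainGroup.ofChain_nonneg _
  | zero => rw [map_zero]
  | add x y _ _ hx hy =>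
    rw [map_add]
    exact add_nonneg hx hy

end values

end Point

namespace Block

/-! ### Pointwise order and lattice operations in a C-block. -/

section pointwise

variable {E : Type*} [EffectAlgebra E] {𝒥 : CompressionBase E} (hS : 𝒥.IsSpectral)
  (B : 𝒥.Block) {a b c p q r : E}

/-- For $p\in P_\le(b,a)$ put $d=J_p(a)\ominus J_p(b)$. If $d\ne0$, a point in its cover lies in $p$
and there $a$ exceeds $b$. So $d=0$, and $a\le b$ follows by adding the parts under $p$ and $p'$. -/
theorem le_of_val (ha : a ∈ B.cblock) (hb : b ∈ B.cblock)
    (h : ∀ χ : Point hS B, χ.val a ≤ χ.val b) : a ≤ b := by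
  obtain ⟨p, hp⟩ := B.exists_comparison hS hb ha
  have hpB := B.Ple_subset hb ha hp
  have hpP := B.proj hpB
  obtain ⟨-, ⟨d, hd⟩, ⟨e, he⟩⟩ := hp
  have hbC := B.J_mem hpB hb
  have haC := B.J_mem hpB ha
  have hdC := B.cblock.mem_of_oplus hbC haC hd
  have hd0 : d = 0 := by
    by_contra h0
    have hcB := B.cover_mem hS hdC
    obtain ⟨χ, hχ⟩ := Point.exists_mem hS hcB fun h1 => h0 (cover_zero_of hS.2 h1)
    have h1 := (χ.mem_cover_iff hdC).1 hχ
    have h2 : p ∈ χ := χ.mem_of_le _ hχ _ hpB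
      ((hS.2.le_iff hpP).1 ((le_of_oplus' hd).trans (𝒥.J_le hpP a)))
    have h3 := χ.val_add hbC hdC hd
    rw [χ.val_J_of_mem h2 ha, χ.val_J_of_mem h2 hb] at h3
    have := h χ
    grind
  rw [hd0, oplus_zero] at hd
  have h1 := ha p hpB
  have h2 := hb p hpB
  simp only [commutant, Set.mem_ofPred_eq] at h1 h2
  rw [← Option.some.inj hd] at h1
  obtain ⟨f, hf, hf'⟩ := oplus_assoc_left he h2
  exact ⟨e, oplus_inj hf h1 ▸ hf'⟩

theorem eq_of_val (ha : a ∈ B.cblock) (hb : b ∈ B.cblock)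
    (h : ∀ χ : Point hS B, χ.val a = χ.val b) : a = b :=
  le_antisymm (B.le_of_val hS ha hb fun χ => (h χ).le) (B.le_of_val hS hb ha fun χ => (h χ).ge)

theorem exists_oplus_of_val (ha : a ∈ B.cblock) (hb : b ∈ B.cblock)
    (h : ∀ χ : Point hS B, χ.val a + χ.val b ≤ χ.val 1) :
    ∃ c ∈ B.cblock, oplus a b = some c ∧ ∀ χ : Point hS B, χ.val c = χ.val a + χ.val b := by
  obtain ⟨c, hc⟩ := exists_oplus_of_le_orth
    (B.le_of_val hS ha (B.cblock.orth_mem _ hb) fun χ => by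
      rw [χ.val_orth hb]
      exact le_sub_iff_add_le.2 (h χ))
  exact ⟨c, B.cblock.oplus_mem _ ha _ hb _ hc, hc, fun χ => (χ.val_add ha hb hc).symm⟩

theorem le_iff_forall_mem (hp : p ∈ B.carrier) (hq : q ∈ B.carrier) :
    p ≤ q ↔ ∀ χ : Point hS B, p ∈ χ → q ∈ χ := by
  refine ⟨fun h χ hpχ => χ.mem_of_le p hpχ q hq h, fun h => ?_⟩
  refine B.le_of_val hS (B.mem_cblock hp) (B.mem_cblock hq) fun χ => ?_
  have := h χ
  rw [χ.val_proj hp, χ.val_proj hq]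
  have := χ.val_one_pos
  grind

/-- For $p\in P_\le(a,b)$ the minimum is $J_p(a)\oplus J_{p'}(b)$. -/
theorem exists_min (ha : a ∈ B.cblock) (hb : b ∈ B.cblock) :
    ∃ c ∈ B.cblock, ∀ χ : Point hS B, χ.val c = min (χ.val a) (χ.val b) := by
  obtain ⟨p, hp⟩ := B.exists_comparison hS ha hb
  have hpB := B.Ple_subset ha hb hp
  have hpB' := B.orth_mem hpB
  obtain ⟨-, h1, h2⟩ := hp
  have haC := B.J_mem hpB ha
  have hbC := B.J_mem hpB' hb
  have key : ∀ χ : Point hS B,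
      χ.val (𝒥.J p a) + χ.val (𝒥.J (orth p) b) = min (χ.val a) (χ.val b) := fun χ => by
    have e1 := χ.val_mono haC (B.J_mem hpB hb) h1
    have e2 := χ.val_mono hbC (B.J_mem hpB' ha) h2
    have e3 := χ.orth_mem_iff hpB
    rw [χ.val_J hpB ha, χ.val_J hpB hb] at e1
    rw [χ.val_J hpB' ha, χ.val_J hpB' hb] at e2
    rw [χ.val_J hpB ha, χ.val_J hpB' hb]
    grind
  obtain ⟨c, hc, -, hc'⟩ := B.exists_oplus_of_val hS haC hbC fun χ => by
    rw [key χ]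
    exact (min_le_left _ _).trans (χ.val_le_one ha)
  exact ⟨c, hc, fun χ => by rw [hc', key]⟩

/-- Truncated addition in a C-block. -/
theorem exists_truncated_add (ha : a ∈ B.cblock) (hb : b ∈ B.cblock) :
    ∃ c ∈ B.cblock, ∀ χ : Point hS B, χ.val c = min (χ.val a + χ.val b) (χ.val 1) := by
  -- The truncated sum is $a\oplus(b\wedge a')$.
  obtain ⟨m, hm, hm'⟩ := B.exists_min hS hb (B.cblock.orth_mem _ ha)
  have key : ∀ χ : Point hS B, χ.val a + χ.val m = min (χ.val a + χ.val b) (χ.val 1) := fun χ => by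
    rw [hm', χ.val_orth ha]
    grind
  obtain ⟨c, hc, -, hc'⟩ := B.exists_oplus_of_val hS ha hm fun χ => by
    rw [key χ]
    exact min_le_right _ _
  exact ⟨c, hc, fun χ => by rw [hc', key]⟩

/-! ### The universal group of a C-block -/

/-- The cone is generated by $C$, and for nonnegative values
$\min(x+y,1)=\min(\min(x,1)+\min(y,1),1)$. The truncation lies in $C$, so it has a cover in $B$ even
though $x$ is only a group element. -/
theorem exists_truncation {x : UnivGroup B.cblock} (hx : x ∈ UnivGroup.posCone B.cblock) :
    ∃ c ∈ B.cblock, ∀ χ : Point hS B, χ.val c = min (χ.ev x) (χ.val 1) := by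
  induction hx using AddSubmonoid.closure_induction with
  | mem x hx =>
    obtain ⟨a, rfl⟩ := hx
    refine ⟨a, a.2, fun χ => ?_⟩
    rw [χ.ev_of, ← χ.val_eq, min_eq_left (χ.val_le_one a.2)]
  | zero => exact ⟨0, B.cblock.zero_mem, fun χ => by
      rw [map_zero, χ.val_zero, min_eq_left χ.val_one_pos.le]⟩
  | add x y hx hy ihx ihy =>
    obtain ⟨a, ha, ha'⟩ := ihx
    obtain ⟨b, hb, hb'⟩ := ihy
    obtain ⟨c, hc, hc'⟩ := B.exists_truncated_add hS ha hb
    refine ⟨c, hc, fun χ => ?_⟩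
    have h1 := χ.ev_nonneg hx
    have h2 := χ.ev_nonneg hy
    have h3 := χ.val_one_pos
    rw [hc', ha', hb', map_add]
    clear * - h1 h2 h3
    grind

/-- Nonnegative summands of a sum vanishing at a point vanish there, which reduces the claim to
generators. Injectivity of evaluation on the whole group is not needed. -/
theorem eq_zero_of_ev {x : UnivGroup B.cblock} (hx : x ∈ UnivGroup.posCone B.cblock)
    (h : ∀ χ : Point hS B, χ.ev x = 0) : x = 0 := by
  induction hx using AddSubmonoid.closure_induction with
  | mem x hx =>
    obtain ⟨a, rfl⟩ := hx
    have : (a : E) = 0 := B.eq_of_val hS a.2 B.cblock.zero_mem fun χ => by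
      rw [χ.val_eq, ← χ.ev_of, h, χ.val_zero]
    have h0 : a = 0 := Subtype.ext this
    rw [h0, UnivGroup.of_zero]
  | zero => rfl
  | add x y hx hy ihx ihy =>
    rw [ihx fun χ => ?_, ihy fun χ => ?_, add_zero] <;>
    · have h1 := χ.ev_nonneg hx
      have h2 := χ.ev_nonneg hy
      have h3 := h χ
      rw [map_add] at h3
      grind

theorem compr_of (p : B.carrier) (a : B.cblock) :
    B.compr p (UnivGroup.of a) = UnivGroup.of (B.restrict p a) := UnivGroup.extend_of _ _ _

theorem compr_add_compr_compl (p : B.carrier) (g : UnivGroup B.cblock) :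
    B.compr p g + B.compr (B.compl p) g = g := by
  have : B.compr p + B.compr (B.compl p) = AddMonoidHom.id _ := UnivGroup.hom_ext fun a => by
    rw [AddMonoidHom.add_apply, compr_of, compr_of]
    exact UnivGroup.of_add ((SubEffectAlgebra.oplus_eq_some _ _ _ _).2 (a.2 p p.2))
  exact DFunLike.congr_fun this g

theorem compr_mem_posCone (p : B.carrier) {x : UnivGroup B.cblock}
    (hx : x ∈ UnivGroup.posCone B.cblock) : B.compr p x ∈ UnivGroup.posCone B.cblock := by
  induction hx using AddSubmonoid.closure_induction with
  | mem x hx =>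
    obtain ⟨a, rfl⟩ := hx
    rw [compr_of]
    exact AddSubmonoid.subset_closure ⟨_, rfl⟩
  | zero =>
    rw [map_zero]
    exact AddSubmonoid.zero_mem _
  | add x y _ _ hx hy =>
    rw [map_add]
    exact add_mem hx hy

theorem compr_comm (p q : B.carrier) (g : UnivGroup B.cblock) :
    B.compr p (B.compr q g) = B.compr q (B.compr p g) := by
  have : (B.compr p).comp (B.compr q) = (B.compr q).comp (B.compr p) :=
    UnivGroup.hom_ext fun a => by
      simp only [AddMonoidHom.comp_apply, compr_of]
      congr 1
      exact Subtype.ext (B.J_comm p.2 q.2 a)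
  exact DFunLike.congr_fun this g

theorem compr_compr_congr {p q r : B.carrier} (h : 𝒥.J p q = 𝒥.J p r) (g : UnivGroup B.cblock) :
    B.compr p (B.compr q g) = B.compr p (B.compr r g) := by
  have : (B.compr p).comp (B.compr q) = (B.compr p).comp (B.compr r) :=
    UnivGroup.hom_ext fun a => by
      simp only [AddMonoidHom.comp_apply, compr_of]
      congr 1
      refine Subtype.ext ?_
      change 𝒥.J p (𝒥.J q a) = 𝒥.J p (𝒥.J r a)
      rw [← B.J_J_eq p.2 q.2, h, B.J_J_eq p.2 r.2]
  exact DFunLike.congr_fun this g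

theorem J_orth_congr {p q r : B.carrier} (h : 𝒥.J p q = 𝒥.J p r) :
    𝒥.J p (orth q) = 𝒥.J p (orth r) := by
  have h1 := 𝒥.additive (B.proj p.2) _ _ _ (oplus_orth (q : E))
  have h2 := 𝒥.additive (B.proj p.2) _ _ _ (oplus_orth (r : E))
  rw [h] at h1
  exact oplus_cancel h1 h2

/-- Take $r=J_s(p)\oplus J_{s'}(q)$. -/
theorem exists_glue (s p q : B.carrier) :
    ∃ r : B.carrier, 𝒥.J s r = 𝒥.J s p ∧ 𝒥.J (orth s) r = 𝒥.J (orth s) q := by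
  have hs := B.proj s.2
  have hs' := 𝒥.orth_mem hs
  have h1 := 𝒥.J_le hs p
  have h2 := 𝒥.J_le hs' q
  obtain ⟨r, hr⟩ := exists_oplus_of_le_orth (h1.trans (le_orth_comm h2))
  refine ⟨⟨r, B.oplus_mem_carrier (B.J_mem_carrier s.2 p.2)
    (B.J_mem_carrier (B.orth_mem s.2) q.2) hr⟩, ?_, ?_⟩
  · have := 𝒥.additive hs _ _ _ hr
    rw [𝒥.J_J hs, 𝒥.J_orth_J hs, oplus_zero] at this
    exact (Option.some.inj this).symm
  · have := 𝒥.additive hs' _ _ _ hr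
    rw [𝒥.J_J hs', 𝒥.J_J_orth hs, zero_oplus] at this
    exact (Option.some.inj this).symm

/-- `p` splits `g` into a positive and a negative part. -/
def Splits (g : UnivGroup B.cblock) (p : B.carrier) : Prop :=
  B.compr p g ∈ UnivGroup.posCone B.cblock ∧
    -B.compr (B.compl p) g ∈ UnivGroup.posCone B.cblock

theorem Splits.localize {s p r : B.carrier} {g h : UnivGroup B.cblock} (hp : B.Splits h p)
    (hr : 𝒥.J s r = 𝒥.J s p) (hgh : B.compr s g = B.compr s h) :
    B.compr s (B.compr r g) ∈ UnivGroup.posCone B.cblock ∧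
      B.compr s (-B.compr (B.compl r) g) ∈ UnivGroup.posCone B.cblock := by
  rw [map_neg, B.compr_compr_congr hr,
    B.compr_compr_congr (q := B.compl r) (r := B.compl p) (B.J_orth_congr hr), B.compr_comm,
    B.compr_comm s, hgh, B.compr_comm, B.compr_comm _ s, ← map_neg]
  exact ⟨B.compr_mem_posCone s hp.1, B.compr_mem_posCone s hp.2⟩

/-- General comparability in the universal group of a C-block. -/
theorem exists_splits (hS : 𝒥.IsSpectral) (L M : List B.cblock) :
    ∃ p, B.Splits ((L.map UnivGroup.of).sum - (M.map UnivGroup.of).sum) p := by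
  have hsum : ∀ L : List B.cblock, (L.map UnivGroup.of).sum ∈ UnivGroup.posCone B.cblock :=
    fun L => by
      refine AddSubmonoid.list_sum_mem _ fun x hx => ?_
      obtain ⟨a, -, rfl⟩ := List.mem_map.1 hx
      exact AddSubmonoid.subset_closure ⟨_, rfl⟩
  have hone : ∀ g, B.compr ⟨1, B.one_mem⟩ g = g := fun g => by
    have : B.compr ⟨1, B.one_mem⟩ = AddMonoidHom.id _ := UnivGroup.hom_ext fun a => by
      rw [compr_of]
      exact congrArg UnivGroup.of (Subtype.ext (𝒥.J_of_le 𝒥.P.one_mem (le_one' _)))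
    rw [this]
    rfl
  have hzero : ∀ g, B.compr (B.compl ⟨1, B.one_mem⟩) g = 0 := fun g => by
    have := B.compr_add_compr_compl ⟨1, B.one_mem⟩ g
    rwa [hone, add_eq_left] at this
  -- Induction on the total number of summands; if one list is empty, the projection $0$ or $1$
  -- splits.
  induction hn : L.length + M.length using Nat.strong_induction_on generalizing L M with
  | _ n ih =>
  rcases L with _ | ⟨c, L⟩
  · refine ⟨B.compl ⟨1, B.one_mem⟩, ?_, ?_⟩
    · rw [hzero]
      exact AddSubmonoid.zero_mem _
    · have e : B.compl (B.compl ⟨1, B.one_mem⟩) = ⟨1, B.one_mem⟩ := Subtype.ext (orth_orth _)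
      rw [e, hone]
      simpa using hsum M
  rcases M with _ | ⟨d, M⟩
  · refine ⟨⟨1, B.one_mem⟩, ?_, ?_⟩
    · rw [hone]
      simpa using hsum (c :: L)
    · rw [hzero, neg_zero]
      exact AddSubmonoid.zero_mem _
  -- Comparing the heads cancels one summand: on $s$ the pair $c-d$ becomes a single $e\in C$, and
  -- on $s'$ the pair $d-c$ becomes a single $f\in C$. The projections for the two shorter
  -- differences are glued along $s$.
  obtain ⟨s, hs⟩ := B.exists_comparison hS d.2 c.2
  have hsB := B.Ple_subset d.2 c.2 hs
  have hdiff : ∀ (s : B.carrier) (x y : B.cblock), 𝒥.J s x ≤ 𝒥.J s y →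
      ∃ e : B.cblock, B.compr s (UnivGroup.of y) - B.compr s (UnivGroup.of x) =
        B.compr s (UnivGroup.of e) := by
    rintro s x y ⟨e, he⟩
    have heC := B.cblock.mem_of_oplus (B.J_mem s.2 x.2) (B.J_mem s.2 y.2) he
    refine ⟨⟨e, heC⟩, ?_⟩
    have h1 : oplus (B.restrict s x) ⟨e, heC⟩ = some (B.restrict s y) :=
      (SubEffectAlgebra.oplus_eq_some _ _ _ _).2 he
    have h2 : B.restrict s ⟨e, heC⟩ = ⟨e, heC⟩ :=
      Subtype.ext (𝒥.J_of_le (B.proj s.2) ((le_of_oplus' he).trans (𝒥.J_le (B.proj s.2) _)))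
    rw [compr_of, compr_of, compr_of, h2, ← UnivGroup.of_add h1, add_sub_cancel_left]
  obtain ⟨-, h1, h2⟩ := hs
  obtain ⟨e, he⟩ := hdiff ⟨s, hsB⟩ d c h1
  obtain ⟨f, hf⟩ := hdiff (B.compl ⟨s, hsB⟩) c d h2
  obtain ⟨p, hp⟩ := ih _ (by simp only [List.length_cons] at hn ⊢; omega) (e :: L) M rfl
  obtain ⟨q, hq⟩ := ih _ (by simp only [List.length_cons] at hn ⊢; omega) L (f :: M) rfl
  obtain ⟨r, hr, hr'⟩ := B.exists_glue ⟨s, hsB⟩ p q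
  have k1 := Splits.localize (s := ⟨s, hsB⟩) (g := ((c :: L).map UnivGroup.of).sum -
    ((d :: M).map UnivGroup.of).sum) B hp hr (by
      simp only [List.map_cons, List.sum_cons, map_sub, map_add, ← he]
      abel)
  have k2 := Splits.localize (s := B.compl ⟨s, hsB⟩) (g := ((c :: L).map UnivGroup.of).sum -
    ((d :: M).map UnivGroup.of).sum) B hq hr' (by
      simp only [List.map_cons, List.sum_cons, map_sub, map_add, ← hf]
      abel)
  refine ⟨r, ?_, ?_⟩
  · rw [← B.compr_add_compr_compl ⟨s, hsB⟩ (B.compr r _)]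
    exact add_mem k1.1 k2.1
  · rw [← B.compr_add_compr_compl ⟨s, hsB⟩ (-B.compr (B.compl r) _)]
    exact add_mem k1.2 k2.2

theorem Splits.isPosPart {g : UnivGroup B.cblock} {p : B.carrier} (h : B.Splits g p) :
    B.IsPosPart g (B.compr p g) :=
  ⟨_, h.1, h.2, by rw [sub_neg_eq_add, B.compr_add_compr_compl], p, rfl, by rw [neg_neg]⟩

-- At each point one of $p,p'$ is absent from $\chi$, so one of the two parts vanishes there. The
-- values of a positive part are thus forced.
variable {hS} in
theorem IsPosPart.ev_eq {g x : UnivGroup B.cblock} (h : B.IsPosPart g x) (χ : Point hS B) :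
    χ.ev x = max (χ.ev g) 0 := by
  obtain ⟨y, hx, hy, rfl, p, hp, hp'⟩ := h
  have h1 := χ.ev_nonneg hx
  have h2 := χ.ev_nonneg hy
  have h3 : χ.ev x = 0 ∨ χ.ev y = 0 := by
    by_cases hpχ : (p : E) ∈ χ
    · right
      have : (B.compl p : E) ∉ χ := χ.orth_notMem hpχ
      have := χ.ev_compr_of_notMem _ this (x - y)
      rw [hp', map_neg, neg_eq_zero] at this
      exact this
    · left
      have := χ.ev_compr_of_notMem _ hpχ (x - y)
      rwa [hp] at this
  rw [map_sub]
  grind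

/-- Every $p\in B$ splits every group element, so the compatibility clause is automatic; $\tilde
U_p(x)=0$ says that $x$ vanishes on $p$. -/
theorem isRickart_iff {x : UnivGroup B.cblock} (hx : x ∈ UnivGroup.posCone B.cblock)
    (hq : q ∈ B.carrier) (h : ∀ χ : Point hS B, q ∈ χ ↔ χ.ev x ≤ 0) :
    B.IsRickart x r ↔ r = q := by
  have key : ∀ p : B.carrier, (p : E) ≤ q ↔
      x = B.compr p x + B.compr (B.compl p) x ∧ B.compr p x = 0 := by
    intro p
    rw [B.le_iff_forall_mem hS p.2 hq, and_iff_right (B.compr_add_compr_compl p x).symm]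
    constructor
    · refine fun h1 => B.eq_zero_of_ev hS (B.compr_mem_posCone p hx) fun χ => ?_
      by_cases hp : (p : E) ∈ χ
      · rw [χ.ev_compr_of_mem p hp]
        exact le_antisymm ((h χ).1 (h1 χ hp)) (χ.ev_nonneg hx)
      · exact χ.ev_compr_of_notMem p hp x
    · intro h1 χ hp
      rw [h, ← χ.ev_compr_of_mem p hp, h1, map_zero]
  constructor
  · rintro ⟨hr, hr'⟩
    exact le_antisymm ((key ⟨r, hr⟩).2 ((hr' ⟨r, hr⟩).1 le_rfl))
      ((hr' ⟨q, hq⟩).2 ((key ⟨q, hq⟩).1 le_rfl))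
  · rintro rfl
    exact ⟨hq, key⟩

/-- The spectral projection in a C-block is the complement of the cover of the element
`(n a - m 1)_+ ∧ 1`. -/
theorem exists_isSpectralProj_iff (ha : a ∈ B.cblock) (m n : ℕ) :
    ∃ b ∈ B.cblock, (∀ χ : Point hS B,
      χ.val b = min (max (n • χ.val a - m • χ.val 1) 0) (χ.val 1)) ∧
      ∀ r, B.IsSpectralProj ⟨a, ha⟩ m n r ↔ r = orth (𝒥.cover b) := by
  obtain ⟨p, hp⟩ := B.exists_splits hS (List.replicate n ⟨a, ha⟩) (List.replicate m 1)
  rw [List.map_replicate, List.sum_replicate, List.map_replicate, List.sum_replicate,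
    ← natCast_zsmul _ m] at hp
  have hpos := hp.isPosPart
  have hev : ∀ (χ : Point hS B) x, B.IsPosPart
      (n • UnivGroup.of ⟨a, ha⟩ - (m : ℤ) • UnivGroup.of 1) x →
      χ.ev x = max (n • χ.val a - m • χ.val 1) 0 := fun χ x hx => by
    have h1 : χ.val (1 : E) = χ.cval 1 := χ.val_eq 1
    rw [IsPosPart.ev_eq B hx χ, map_sub, map_nsmul, map_zsmul, natCast_zsmul, χ.ev_of, χ.ev_of,
      χ.val_eq ⟨a, ha⟩, h1]
  obtain ⟨b, hb, hb'⟩ := B.exists_truncation hS hp.1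
  refine ⟨b, hb, fun χ => by rw [hb', hev χ _ hpos], fun r => ?_⟩
  -- All positive parts have the same values, so each of them has the same Rickart projection.
  have key : ∀ x, B.IsPosPart (n • UnivGroup.of ⟨a, ha⟩ - (m : ℤ) • UnivGroup.of 1) x →
      (B.IsRickart x r ↔ r = orth (𝒥.cover b)) := fun x hx => by
    refine B.isRickart_iff hS hx.choose_spec.1 (B.orth_mem (B.cover_mem hS hb)) fun χ => ?_
    rw [χ.orth_mem_iff (B.cover_mem hS hb), χ.mem_cover_iff hb, hb', hev χ _ hpos, hev χ _ hx]
    have := χ.val_one_pos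
    grind
  constructor
  · rintro ⟨x, hx, hr⟩
    exact (key x hx).1 hr
  · intro hr
    exact ⟨_, hpos, (key _ hpos).2 hr⟩

end pointwise

/-! ### Pointwise description of the binary spectral projections. -/

section binary

variable {E : Type*} [EffectAlgebra E] {𝒥 : CompressionBase E} (hS : 𝒥.IsSpectral)
  (B : 𝒥.Block) {a b c p q r u : E}

/-- On $p\in P_\le(a,b)$ the element is $b-a\ge0$; off $p$ it vanishes while $b\le a$. -/
theorem posDiff_spec (ha : a ∈ B.cblock) (hb : b ∈ B.cblock) :
    𝒥.posDiff b a ∈ B.cblock ∧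
      ∀ χ : Point hS B, χ.val (𝒥.posDiff b a) = max (χ.val b - χ.val a) 0 := by
  have hex : ∃ x, ∃ p ∈ 𝒥.Ple a b, oplus (𝒥.J p a) x = some (𝒥.J p b) := by
    obtain ⟨p, hp⟩ := B.exists_comparison hS ha hb
    obtain ⟨x, hx⟩ := hp.2.1
    exact ⟨x, p, hp, hx⟩
  obtain ⟨p, hp, hx⟩ : ∃ p ∈ 𝒥.Ple a b, oplus (𝒥.J p a) (𝒥.posDiff b a) = some (𝒥.J p b) :=
    Classical.epsilon_spec hex
  have hpB := B.Ple_subset ha hb hp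
  have hpB' := B.orth_mem hpB
  have hC := B.cblock.mem_of_oplus (B.J_mem hpB ha) (B.J_mem hpB hb) hx
  refine ⟨hC, fun χ => ?_⟩
  have h1 := χ.val_add (B.J_mem hpB ha) hC hx
  have h2 := χ.val_mono (B.J_mem hpB' hb) (B.J_mem hpB' ha) hp.2.2
  have h3 := χ.val_nonneg (𝒥.posDiff b a)
  have h4 := χ.orth_mem_iff hpB
  rw [χ.val_J hpB ha, χ.val_J hpB hb] at h1
  rw [χ.val_J hpB' ha, χ.val_J hpB' hb] at h2
  clear * - h1 h2 h3 h4
  grind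

theorem splitU0_spec (hc : c ∈ B.cblock) (hu : u ∈ B.carrier) :
    𝒥.splitU0 c u ∈ B.carrier ∧ ∀ χ : Point hS B,
      𝒥.splitU0 c u ∈ χ ↔ u ∈ χ ∧ χ.val c + χ.val c ≤ χ.val 1 := by
  have hc' := B.cblock.orth_mem _ hc
  obtain ⟨h1, h2⟩ := B.posDiff_spec hS hc' hc
  have h3 := B.cover_mem hS h1
  have h4 := B.orth_mem h3
  have h5 : 𝒥.splitU0 c u = 𝒥.J u (orth (𝒥.cover (𝒥.posDiff c (orth c)))) :=
    B.meet_eq hu (B.mem_cblock h4)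
  rw [h5]
  refine ⟨B.J_mem_carrier hu h4, fun χ => ?_⟩
  rw [χ.J_mem_iff hu h4, χ.orth_mem_iff h3, χ.mem_cover_iff h1, h2, χ.val_orth hc]
  refine and_congr_right fun _ => ?_
  grind

theorem splitU1_spec (hc : c ∈ B.cblock) (hu : u ∈ B.carrier) :
    𝒥.splitU1 c u ∈ B.carrier ∧ ∀ χ : Point hS B,
      𝒥.splitU1 c u ∈ χ ↔ u ∈ χ ∧ χ.val 1 < χ.val c + χ.val c := by
  obtain ⟨h1, h2⟩ := B.splitU0_spec hS hc hu
  have h3 := B.orth_mem h1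
  have h5 : 𝒥.splitU1 c u = 𝒥.J (orth (𝒥.splitU0 c u)) u := B.meet_eq h3 (B.mem_cblock hu)
  rw [h5]
  refine ⟨B.J_mem_carrier h3 hu, fun χ => ?_⟩
  rw [χ.J_mem_iff h3 hu, χ.orth_mem_iff h1, h2, not_and, not_le, and_comm]
  exact and_congr_right fun h => ⟨fun h' => h' h, fun h' _ => h'⟩

open Classical in
theorem splitC1_spec (hc : c ∈ B.cblock) (hu : u ∈ B.carrier) :
    𝒥.splitC1 c u ∈ B.cblock ∧ ∀ χ : Point hS B, χ.val (𝒥.splitC1 c u) =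
      if u ∈ χ then max (χ.val c + χ.val c - χ.val 1) 0 else 0 := by
  obtain ⟨h1, h2⟩ := B.posDiff_spec hS (B.cblock.orth_mem _ hc) hc
  have h5 : 𝒥.splitC1 c u = 𝒥.J u (𝒥.posDiff c (orth c)) := B.meet_eq hu h1
  rw [h5]
  refine ⟨B.J_mem hu h1, fun χ => ?_⟩
  rw [χ.val_J hu h1, h2, χ.val_orth hc]
  congr 2
  abel

open Classical in
theorem splitC0_spec (hc : c ∈ B.cblock) (hu : u ∈ B.carrier) :
    𝒥.splitC0 c u ∈ B.cblock ∧ ∀ χ : Point hS B, χ.val (𝒥.splitC0 c u) =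
      if 𝒥.splitU0 c u ∈ χ then χ.val c + χ.val c else 0 := by
  obtain ⟨h1, h2⟩ := B.posDiff_spec hS hc (B.cblock.orth_mem _ hc)
  obtain ⟨h3, h4⟩ := B.splitU0_spec hS hc hu
  have h5 : meet (𝒥.posDiff (orth c) c) u = 𝒥.J u (𝒥.posDiff (orth c) c) := B.meet_eq hu h1
  have h6 := B.J_mem hu h1
  -- Within $u$, $(c'-c)_+$ is $1-2c$ on $u_{w0}$ and $0$ elsewhere, so subtracting it from $u_{w0}$
  -- leaves $2c$ there.
  have h7 : ∀ χ : Point hS B, χ.val (𝒥.J u (𝒥.posDiff (orth c) c)) +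
      (if 𝒥.splitU0 c u ∈ χ then χ.val c + χ.val c else 0) = χ.val (𝒥.splitU0 c u) := fun χ => by
    have h8 := h4 χ
    have h9 := χ.val_nonneg c
    rw [χ.val_J hu h1, h2, χ.val_orth hc, χ.val_proj h3]
    clear * - h8 h9
    grind
  obtain ⟨d, hd⟩ : 𝒥.J u (𝒥.posDiff (orth c) c) ≤ 𝒥.splitU0 c u :=
    B.le_of_val hS h6 (B.mem_cblock h3) fun χ => by
      rw [← h7 χ]
      have h9 := χ.val_nonneg c
      refine le_add_of_nonneg_right ?_
      split_ifs
      · exact add_nonneg h9 h9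
      · exact le_rfl
  have h8 : 𝒥.splitC0 c u = d := by
    unfold splitC0
    rw [h5, ominus_eq hd]
  have h9 := B.cblock.mem_of_oplus h6 (B.mem_cblock h3) hd
  rw [h8]
  refine ⟨h9, fun χ => ?_⟩
  have h10 := χ.val_add h6 h9 hd
  rw [← h7 χ] at h10
  exact add_left_cancel h10

open Classical in
/-- At a point, `u_w` is the indicator of `k / 2 ^ n < a ≤ (k + 1) / 2 ^ n`, and there
`c_w = 2 ^ n a - k`. -/
theorem cu_spec (ha : a ∈ B.cblock) (n k : ℕ) (hk : k < 2 ^ n) :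
    (𝒥.cu a n k).1 ∈ B.cblock ∧ (𝒥.cu a n k).2 ∈ B.carrier ∧ ∀ χ : Point hS B,
      ((𝒥.cu a n k).2 ∈ χ ↔
        k • χ.val 1 < 2 ^ n • χ.val a ∧ 2 ^ n • χ.val a ≤ (k + 1) • χ.val 1) ∧
      χ.val (𝒥.cu a n k).1 =
        if (𝒥.cu a n k).2 ∈ χ then 2 ^ n • χ.val a - k • χ.val 1 else 0 := by
  induction n generalizing k with
  | zero =>
    obtain rfl : k = 0 := by simpa using hk
    refine ⟨ha, B.cover_mem hS ha, fun χ => ?_⟩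
    have h1 := χ.mem_cover_iff ha
    have h2 := χ.val_nonneg a
    have h3 := χ.val_le_one ha
    simp only [cu, zero_smul, pow_zero, one_smul, zero_add, sub_zero, h1]
    clear * - h2 h3
    grind
  | succ n ih =>
    have hk2 : k / 2 < 2 ^ n := by
      rw [Nat.div_lt_iff_lt_mul two_pos, ← pow_succ]
      exact hk
    obtain ⟨hc, hu, h⟩ := ih (k / 2) hk2
    set c := (𝒥.cu a n (k / 2)).1 with hcdef
    set u := (𝒥.cu a n (k / 2)).2 with hudef
    have hcu : 𝒥.cu a (n + 1) k =
        if k % 2 = 0 then (𝒥.splitC0 c u, 𝒥.splitU0 c u) else (𝒥.splitC1 c u, 𝒥.splitU1 c u) := rfl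
    obtain ⟨hC0, hC0'⟩ := B.splitC0_spec hS hc hu
    obtain ⟨hC1, hC1'⟩ := B.splitC1_spec hS hc hu
    obtain ⟨hU0, hU0'⟩ := B.splitU0_spec hS hc hu
    obtain ⟨hU1, hU1'⟩ := B.splitU1_spec hS hc hu
    have hpow : ∀ χ : Point hS B, 2 ^ (n + 1) • χ.val a = 2 ^ n • χ.val a + 2 ^ n • χ.val a :=
      fun χ => by rw [← add_smul, pow_succ, mul_two]
    -- The parity of $k$ is the last binary digit. With $c=2^na-\lfloor k/2\rfloor1$ on $u$, the
    -- test $2c\le1$ bisects the parent interval.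
    rcases Nat.mod_two_eq_zero_or_one k with hk0 | hk1
    · rw [hcu, if_pos hk0]
      refine ⟨hC0, hU0, fun χ => ?_⟩
      obtain ⟨h1, h2⟩ := h χ
      have h3 := hC0' χ
      have h4 := hU0' χ
      have h5 := χ.val_one_pos
      have h6 : k • χ.val 1 = (k / 2) • χ.val 1 + (k / 2) • χ.val 1 := by
        rw [← add_smul]
        congr 1
        omega
      dsimp only
      rw [hpow, add_smul, one_smul, h6]
      rw [add_smul, one_smul] at h1
      generalize 2 ^ n • χ.val a = x at *
      generalize (k / 2) • χ.val 1 = y at *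
      clear * - h1 h2 h3 h4 h5
      grind
    · rw [hcu, if_neg (by omega)]
      refine ⟨hC1, hU1, fun χ => ?_⟩
      obtain ⟨h1, h2⟩ := h χ
      have h3 := hC1' χ
      have h4 := hU1' χ
      have h5 := χ.val_one_pos
      have h6 : k • χ.val 1 = (k / 2) • χ.val 1 + (k / 2) • χ.val 1 + χ.val 1 := by
        rw [← add_smul, ← succ_nsmul]
        congr 1
        omega
      dsimp only
      rw [hpow, add_smul, one_smul, h6]
      rw [add_smul, one_smul] at h1
      generalize 2 ^ n • χ.val a = x at *
      generalize (k / 2) • χ.val 1 = y at *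
      clear * - h1 h2 h3 h4 h5
      grind

theorem exists_oplus_of_disjoint (hp : p ∈ B.carrier) (hq : q ∈ B.carrier)
    (h : ∀ χ : Point hS B, p ∈ χ → q ∉ χ) :
    ∃ r ∈ B.carrier, oplus p q = some r ∧ ∀ χ : Point hS B, r ∈ χ ↔ p ∈ χ ∨ q ∈ χ := by
  obtain ⟨r, -, hr, hr'⟩ := B.exists_oplus_of_val hS (B.mem_cblock hp) (B.mem_cblock hq)
    fun χ => by
      have h1 := h χ
      have h2 := χ.val_one_pos
      rw [χ.val_proj hp, χ.val_proj hq]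
      clear * - h1 h2
      grind
  have hrB := B.oplus_mem_carrier hp hq hr
  refine ⟨r, hrB, hr, fun χ => ?_⟩
  have h1 := h χ
  have h2 := χ.val_one_pos
  rw [χ.mem_iff_val_pos hrB, hr', χ.val_proj hp, χ.val_proj hq]
  clear * - h1 h2
  grind

/-- The intervals $(k/2^n,(k+1)/2^n]$ with $k<i$ are disjoint, so the sum exists, and they tile
$(0,i/2^n]$. -/
theorem sumTo_cu_spec (ha : a ∈ B.cblock) (n i : ℕ) (hi : i ≤ 2 ^ n) :
    ∃ s ∈ B.carrier, sumTo (fun j => (𝒥.cu a n j).2) i = some s ∧ ∀ χ : Point hS B,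
      s ∈ χ ↔ 0 < χ.val a ∧ 2 ^ n • χ.val a ≤ i • χ.val 1 := by
  have hpos : ∀ χ : Point hS B, 0 < 2 ^ n • χ.val a ↔ 0 < χ.val a := fun χ =>
    nsmul_pos_iff (by positivity)
  induction i with
  | zero =>
    refine ⟨0, B.zero_mem, rfl, fun χ => ?_⟩
    have h1 : (0 : E) ∉ χ := χ.zero_notMem
    have h2 := hpos χ
    rw [zero_smul]
    clear * - h1 h2
    grind
  | succ i ih =>
    obtain ⟨s, hs, hs', h⟩ := ih (by omega)
    obtain ⟨-, hu, hu'⟩ := B.cu_spec hS ha n i (by omega)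
    obtain ⟨r, hr, hr', h'⟩ := B.exists_oplus_of_disjoint hS hs hu fun χ h1 h2 =>
      ((h χ).1 h1).2.not_gt (((hu' χ).1.1 h2).1)
    refine ⟨r, hr, by simp only [sumTo, hs', Option.bind_some, hr'], fun χ => ?_⟩
    rw [h', h, (hu' χ).1]
    have h1 := hpos χ
    have h2 := χ.val_one_pos
    have h3 : 0 ≤ i • χ.val 1 := nsmul_nonneg h2.le i
    rw [add_smul, one_smul]
    clear * - h1 h2 h3
    grind

/-- Clearing denominators: only the ratio of the coefficients matters, so $k/2^l$ may be replaced by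
its reduced form. -/
theorem nsmul_le_nsmul_iff_of_mul_eq {G : Type*} [AddCommGroup G] [LinearOrder G]
    [IsOrderedAddMonoid G] {x y : G} {i j k l : ℕ} (hi : 0 < i) (hk : 0 < k)
    (h : i * l = k * j) : i • x ≤ j • y ↔ k • x ≤ l • y := by
  rw [← nsmul_le_nsmul_iff_right hk.ne', ← nsmul_le_nsmul_iff_right (a := k • x) hi.ne',
    ← mul_smul, ← mul_smul, ← mul_smul, ← mul_smul, ← h, mul_comm k i]

/-- At a point, the binary spectral projection at `k / 2 ^ l` is the indicator of
`a ≤ k / 2 ^ l`. -/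
theorem binaryProj_spec (ha : a ∈ B.cblock) {μ : ℚ} {k l : ℕ} (hμ : μ = k / 2 ^ l) (h0 : 0 < μ)
    (h1 : μ ≤ 1) : 𝒥.binaryProj a μ ∈ B.carrier ∧ ∀ χ : Point hS B,
      𝒥.binaryProj a μ ∈ χ ↔ 2 ^ l • χ.val a ≤ k • χ.val 1 := by
  have hl : (0 : ℚ) < 2 ^ l := by positivity
  unfold binaryProj
  rw [if_neg h0.ne']
  split_ifs with h
  · refine ⟨B.one_mem, fun χ => iff_of_true χ.one_mem ?_⟩
    have hk : k = 2 ^ l := by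
      rw [h, eq_div_iff hl.ne', one_mul] at hμ
      exact_mod_cast hμ.symm
    rw [hk]
    exact nsmul_le_nsmul_right (χ.val_le_one ha) _
  -- The definition reads the level from the reduced denominator, which divides $2^l$ and so is
  -- itself a power of $2$.
  · have hden : μ.den ∣ 2 ^ l := by
      have := Rat.den_dvd (k : ℤ) (2 ^ l : ℕ)
      rw [Rat.divInt_eq_div] at this
      push_cast at this
      rw [← hμ] at this
      exact_mod_cast this
    obtain ⟨n, -, hn⟩ := (Nat.dvd_prime_pow Nat.prime_two).1 hden
    have hlog : Nat.log 2 μ.den = n := by rw [hn, Nat.log_pow one_lt_two]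
    obtain ⟨i, hi⟩ := Int.eq_ofNat_of_zero_le (Rat.num_nonneg.2 h0.le)
    have hμ' : μ = i / 2 ^ n := by
      have := Rat.num_div_den μ
      rw [hi, hn] at this
      push_cast at this
      exact this.symm
    have hn' : (0 : ℚ) < 2 ^ n := by positivity
    have hi1 : i ≤ 2 ^ n := by
      rw [hμ', div_le_one hn'] at h1
      exact_mod_cast h1
    rw [hlog, hi, Int.toNat_natCast]
    obtain ⟨s, hs, hs', h2⟩ := B.sumTo_cu_spec hS ha n i hi1
    have hcB := B.cover_mem hS ha
    obtain ⟨r, hr, hr', h3⟩ := B.exists_oplus_of_disjoint hS (B.orth_mem hcB) hs fun χ h4 h5 =>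
      (χ.orth_mem_iff hcB).1 h4 ((χ.mem_cover_iff ha).2 ((h2 χ).1 h5).1)
    have h4 : the (fun p => ∃ s, sumTo (fun j => (𝒥.cu a n j).2) i = some s ∧
        oplus (orth (𝒥.cover a)) s = some p) = r :=
      the_eq ⟨s, hs', hr'⟩ fun x ⟨s', h5, h6⟩ => by
        obtain rfl : s = s' := Option.some.inj (hs'.symm.trans h5)
        exact oplus_inj h6 hr'
    rw [h4]
    refine ⟨hr, fun χ => ?_⟩
    have h5 : 2 ^ l * i = 2 ^ n * k := by
      rw [hμ', div_eq_div_iff hn'.ne' hl.ne'] at hμ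
      have : i * 2 ^ l = k * 2 ^ n := by exact_mod_cast hμ
      linarith
    rw [nsmul_le_nsmul_iff_of_mul_eq (by positivity) (by positivity) h5, h3, h2,
      χ.orth_mem_iff hcB, χ.mem_cover_iff ha]
    have h6 := χ.val_nonneg a
    have h7 : 0 ≤ i • χ.val 1 := nsmul_nonneg χ.val_one_pos.le i
    -- The sum of the $u_w$ misses the points where $a=0$; the summand $(a^\circ)'$ supplies them.
    constructor
    · rintro (h8 | h8)
      · rw [le_antisymm (not_lt.1 h8) h6, smul_zero]
        exact h7
      · exact h8.2
    · intro h8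
      by_cases h9 : 0 < χ.val a
      · exact Or.inr ⟨h9, h8⟩
      · exact Or.inl h9

end binary

/-! ### The infimum of the binary projections and the archimedean property. -/

section infimum

variable {E : Type*} [EffectAlgebra E] {𝒥 : CompressionBase E} (hS : 𝒥.IsSpectral)
  (B : 𝒥.Block) {a b c : E}

theorem sumTo_const_spec (hc : c ∈ B.cblock) (N : ℕ)
    (h : ∀ χ : Point hS B, N • χ.val c ≤ χ.val 1) :
    ∃ s ∈ B.cblock, sumTo (fun _ => c) N = some s ∧ ∀ χ : Point hS B, χ.val s = N • χ.val c := by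
  induction N with
  | zero => exact ⟨0, B.cblock.zero_mem, rfl, fun χ => by rw [χ.val_zero, zero_smul]⟩
  | succ N ih =>
    obtain ⟨s, hs, hs', h'⟩ := ih fun χ => le_trans (by
      rw [add_smul, one_smul]
      exact le_add_of_nonneg_right (χ.val_nonneg c)) (h χ)
    obtain ⟨r, hr, hr', h''⟩ := B.exists_oplus_of_val hS hs hc fun χ => by
      have := h χ
      rwa [add_smul, one_smul, ← h'] at this
    exact ⟨r, hr, by simp only [sumTo, hs', Option.bind_some, hr'], fun χ => by
      rw [h'', h', add_smul, one_smul]⟩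

/-- Take $2^l\ge Nn$ and $k=\lfloor m2^l/n\rfloor+1$. Then $e=nk-m2^l$ is $n$ minus a remainder, so
$0<e\le n$; $k\le2^l$ because $m<n$. -/
theorem exists_dyadic_gt {m n : ℕ} (hn : 0 < n) (hmn : m < n) (N : ℕ) :
    ∃ k l e : ℕ, n * k = m * 2 ^ l + e ∧ 0 < e ∧ N * e ≤ 2 ^ l ∧ k ≤ 2 ^ l := by
  obtain ⟨l, hl⟩ : ∃ l, N * n ≤ 2 ^ l := ⟨_, Nat.lt_two_pow_self.le⟩
  have h1 := Nat.div_add_mod (m * 2 ^ l) n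
  have h2 := Nat.mod_lt (m * 2 ^ l) hn
  have h3 : m * 2 ^ l / n < 2 ^ l := by
    rw [Nat.div_lt_iff_lt_mul hn, mul_comm]
    exact Nat.mul_lt_mul_of_pos_left hmn (by positivity)
  refine ⟨m * 2 ^ l / n + 1, l, n - m * 2 ^ l % n, ?_, by omega, ?_, h3⟩
  · rw [mul_add, mul_one]
    omega
  · exact (Nat.mul_le_mul_left N (Nat.sub_le _ _)).trans hl

theorem isGLB_binaryProj (hA : EffectAlgebra.IsArchimedean E) (ha : a ∈ B.cblock)
    (hb : b ∈ B.cblock) {m n : ℕ} (hn : 0 < n) (hmn : m ≤ n)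
    (h : ∀ χ : Point hS B, χ.val b = min (max (n • χ.val a - m • χ.val 1) 0) (χ.val 1)) :
    IsGLB {q : E | ∃ μ : ℚ, (∃ k l : ℕ, μ = k / 2 ^ l) ∧ (m : ℚ) / n < μ ∧ μ ≤ 1 ∧
      q = 𝒥.binaryProj a μ} (orth (𝒥.cover b)) := by
  have hcB := B.cover_mem hS hb
  have hn' : (0 : ℚ) < n := by exact_mod_cast hn
  have hmem : ∀ χ : Point hS B, orth (𝒥.cover b) ∈ χ ↔ n • χ.val a ≤ m • χ.val 1 := fun χ => by
    rw [χ.orth_mem_iff hcB, χ.mem_cover_iff hb, h]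
    have := χ.val_one_pos
    clear * - this
    grind
  constructor
  · rintro q ⟨μ, ⟨k, l, hμ⟩, h1, h2, rfl⟩
    have h0 : 0 < μ := lt_of_le_of_lt (by positivity) h1
    obtain ⟨h3, h4⟩ := B.binaryProj_spec hS ha hμ h0 h2
    rw [B.le_iff_forall_mem hS (B.orth_mem hcB) h3]
    intro χ h5
    rw [h4]
    have h6 := (hmem χ).1 h5
    have h7 : m * 2 ^ l ≤ k * n := by
      rw [hμ, div_lt_div_iff₀ hn' (by positivity)] at h1
      exact_mod_cast h1.le
    rw [← nsmul_le_nsmul_iff_right hn.ne']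
    calc n • 2 ^ l • χ.val a = 2 ^ l • n • χ.val a := smul_comm _ _ _
      _ ≤ 2 ^ l • m • χ.val 1 := nsmul_le_nsmul_right h6 _
      _ = (m * 2 ^ l) • χ.val 1 := by rw [← mul_smul, mul_comm]
      _ ≤ (k * n) • χ.val 1 := nsmul_le_nsmul_left χ.val_one_pos.le h7
      _ = n • k • χ.val 1 := by rw [← mul_smul, mul_comm]
  · intro x hx
    have hqP := hS.2.cover_mem x
    -- With $q=x^\circ$ the claim becomes $b\le q'$, that is $J_q(b)=0$. Neither $x$ nor $q$ need
    -- lie in the C-block.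
    refine (hS.2.le_cover x).trans (le_orth_comm ((hS.2.le_iff (𝒥.orth_mem hqP)).1 ?_))
    rw [← 𝒥.J_eq_zero_iff hqP]
    rcases hmn.eq_or_lt with rfl | hmn
    · have : b = 0 := B.eq_of_val hS hb B.cblock.zero_mem fun χ => by
        have h1 : m • χ.val a ≤ m • χ.val 1 := nsmul_le_nsmul_right (χ.val_le_one ha) _
        have h2 := χ.val_one_pos
        rw [h, χ.val_zero]
        clear * - h1 h2
        grind
      rw [this, 𝒥.J_zero hqP]
    -- For each $N$, a binary projection $p$ close enough above $m/n$ makes $N\,J_p(b)$ exist: on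
    -- $p$, $b\le(na-m1)_+$ gives $2^lb\le e1$, and $Ne\le2^l$.
    refine hA _ fun N => ?_
    obtain ⟨k, l, e, hk, he, hN, hkl⟩ := exists_dyadic_gt hn hmn N
    have hl : (0 : ℚ) < 2 ^ l := by positivity
    have h1 : (m : ℚ) / n < k / 2 ^ l := by
      rw [div_lt_div_iff₀ hn' hl]
      have : m * 2 ^ l < k * n := by
        rw [mul_comm k n, hk]
        omega
      exact_mod_cast this
    have h0 : (0 : ℚ) < k / 2 ^ l := lt_of_le_of_lt (by positivity) h1
    have h2 : (k : ℚ) / 2 ^ l ≤ 1 := by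
      rw [div_le_one hl]
      exact_mod_cast hkl
    have h3 := hx ⟨_, ⟨k, l, rfl⟩, h1, h2, rfl⟩
    obtain ⟨h4, h5⟩ := B.binaryProj_spec hS ha rfl h0 h2
    set p := 𝒥.binaryProj a ((k : ℚ) / 2 ^ l)
    have hpP := B.proj h4
    obtain ⟨s, -, hs, -⟩ := B.sumTo_const_spec hS (B.J_mem h4 hb) N fun χ => by
      classical
      rw [χ.val_J h4 hb]
      split_ifs with h6
      · have h7 : 2 ^ l • χ.val b ≤ e • χ.val 1 := by
          have h8 : n • 2 ^ l • χ.val a ≤ n • k • χ.val 1 :=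
            nsmul_le_nsmul_right ((h5 χ).1 h6) n
          rw [smul_comm, ← mul_smul n k, hk, add_smul, mul_comm m, mul_smul] at h8
          have h9 := nsmul_nonneg χ.val_one_pos.le e
          rcases le_total (n • χ.val a) (m • χ.val 1) with h10 | h10
          · have : χ.val b = 0 := by
              rw [h, max_eq_right (sub_nonpos.2 h10), min_eq_left χ.val_one_pos.le]
            rw [this, smul_zero]
            exact h9
          · have h11 : χ.val b ≤ n • χ.val a - m • χ.val 1 := by
              rw [h, max_eq_left (sub_nonneg.2 h10)]
              exact min_le_left _ _
            calc 2 ^ l • χ.val b ≤ 2 ^ l • (n • χ.val a - m • χ.val 1) :=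
                  nsmul_le_nsmul_right h11 _
              _ = 2 ^ l • n • χ.val a - 2 ^ l • m • χ.val 1 := nsmul_sub _ _ _
              _ ≤ e • χ.val 1 := sub_le_iff_le_add'.2 h8
        rw [← nsmul_le_nsmul_iff_right (pow_ne_zero l two_ne_zero : (2 : ℕ) ^ l ≠ 0)]
        calc 2 ^ l • N • χ.val b = N • 2 ^ l • χ.val b := smul_comm _ _ _
          _ ≤ N • e • χ.val 1 := nsmul_le_nsmul_right h7 _
          _ = (N * e) • χ.val 1 := by rw [mul_smul]
          _ ≤ 2 ^ l • χ.val 1 := nsmul_le_nsmul_left χ.val_one_pos.le hN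
      · rw [smul_zero]
        exact χ.val_one_pos.le
    -- Since $q\le p$, $J_qJ_p(b)=J_q(b)$, so applying $J_q$ shows that $N\,J_q(b)$ exists.
    have h6 := sumTo_map (𝒥.additive hqP) _ N hs
    rw [𝒥.J_J_of_le hpP hqP ((hS.2.le_iff hpP).1 h3) (hb p h4)] at h6
    exact ⟨_, h6⟩

/-- In every C-block that contains `a`, the spectral projection at `m / n` is the infimum of the
binary spectral projections of `a` at the dyadic numbers above `m / n`. -/
theorem exists_spectralProj_isGLB (hS : 𝒥.IsSpectral) (hA : EffectAlgebra.IsArchimedean E)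
    (ha : a ∈ B.cblock)
    {m : ℤ} {n : ℕ} (hn : 0 < n) (h0 : (0 : ℚ) ≤ m / n) (h1 : (m : ℚ) / n ≤ 1) :
    ∃ q ∈ 𝒥.P, (∀ r, B.IsSpectralProj ⟨a, ha⟩ m n r ↔ r = q) ∧
      IsGLB {q : E | ∃ μ : ℚ, (∃ k l : ℕ, μ = k / 2 ^ l) ∧ (m : ℚ) / n < μ ∧ μ ≤ 1 ∧
        q = 𝒥.binaryProj a μ} q := by
  have hn' : (0 : ℚ) < n := by exact_mod_cast hn
  have hm : 0 ≤ m := by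
    rw [le_div_iff₀ hn', zero_mul] at h0
    exact_mod_cast h0
  lift m to ℕ using hm
  have hmn : m ≤ n := by
    rw [div_le_one hn'] at h1
    exact_mod_cast h1
  obtain ⟨b, hb, hb', h⟩ := B.exists_isSpectralProj_iff hS ha m n
  have := B.isGLB_binaryProj hS hA ha hb hn hmn hb'
  exact ⟨_, B.proj (B.orth_mem (B.cover_mem hS hb)), h, by simpa only [Int.cast_natCast] using this⟩

end infimum

end Block

end CompressionBase

theorem mainTheorem2 {E : Type*} [EffectAlgebra E] (𝒥 : CompressionBase E)
    (hS : 𝒥.IsSpectral) (hA : EffectAlgebra.IsArchimedean E) (a : E) :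
    ∃! p : Set.Icc (0 : ℚ) 1 → 𝒥.P, ∀ lam : Set.Icc (0 : ℚ) 1,
      (∀ (B : 𝒥.Block) (ha : a ∈ B.cblock) (m : ℤ) (n : ℕ), 0 < n → (m : ℚ) / n = lam →
        ∀ r : E, B.IsSpectralProj ⟨a, ha⟩ m n r ↔ r = p lam) ∧
      IsGLB {q : E | ∃ μ : ℚ, (∃ k l : ℕ, μ = k / 2 ^ l) ∧ (lam : ℚ) < μ ∧ μ ≤ 1 ∧
        q = 𝒥.binaryProj a μ} (p lam : E) := by
  obtain ⟨B, ha⟩ := CompressionBase.exists_block hS a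
  have key : ∀ lam : Set.Icc (0 : ℚ) 1, ∃ q : 𝒥.P,
      IsGLB {q : E | ∃ μ : ℚ, (∃ k l : ℕ, μ = k / 2 ^ l) ∧ (lam : ℚ) < μ ∧ μ ≤ 1 ∧
        q = 𝒥.binaryProj a μ} (q : E) := by
    rintro ⟨lam, h0, h1⟩
    rw [← Rat.num_div_den lam] at h0 h1
    obtain ⟨q, hq, -, h⟩ := B.exists_spectralProj_isGLB hS hA ha lam.den_pos h0 h1
    rw [Rat.num_div_den] at h
    exact ⟨⟨q, hq⟩, h⟩
  choose p hp using key
  refine ⟨p, fun lam => ⟨fun B ha m n hn hlam r => ?_, hp lam⟩, fun p' hp' => ?_⟩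
  -- In any other block the spectral projection is an infimum of the same set, hence the same
  -- element.
  · obtain ⟨q, -, h, h'⟩ := B.exists_spectralProj_isGLB hS hA ha (m := m) hn
      (hlam ▸ lam.2.1) (hlam ▸ lam.2.2)
    rw [hlam] at h'
    rw [h, h'.unique (hp lam)]
  · funext lam
    exact Subtype.ext ((hp' lam).2.unique (hp lam))
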